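/- Let $a:[0,1]\to\mathbb R$ satisfy $a(0)=0$, $a>0$ on $(0,1]$, and put $K=\sup_{x\in(0,1]}\frac{x|a'(x)|}{a(x)}$. Assume that $a$ is weakly degenerate at $0$ ($a\in C[0,1]\cap C^1(0,1]$ and $K\in(0,1)$) or strongly degenerate at $0$ ($a\in C^1[0,1]$ and $K\in[1,2)$). Let $L^2_{1/a}(0,1)$ be the space of $u\in L^2(0,1)$ with $\|u\|^2_{L^2_{1/a}}=\int_0^1 u^2/a\,dx<\infty$, let $H^2_{1/a}(0,1)=L^2_{1/a}(0,1)\cap H^2_0(0,1)$, with $\|u\|^2_{H^2_{1/a}}=\|u\|^2_{L^2_{1/a}}+\|u'\|^2_{L^2}+\|u''\|^2_{L^2}$, and let $Au=au''''$ for $u\in D(A)=\{u\in H^2_{1/a}(0,1): au''''\in L^2_{1/a}(0,1)\}$. On $\mathcal H_0=H^2_{1/a}(0,1)\times L^2_{1/a}(0,1)$, with $\|(u,v)\|^2_{\mathcal H_0}=\int_0^1 (u'')^2dx+\int_0^1 v^2/a\,dx$, let $\mathcal A(u,v)=(v,-Au)$ with domain $D(A)\times H^2_{1/a}(0,1)$.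 Consider $$y_{tt}+ay_{xxxx}=0\ \text{ in }(0,\infty)\times(0,1),\qquad y(t,0)=y(t,1)=y_x(t,0)=y_x(t,1)=0 .$$ A mild solution is a function $y$ for which $U=(y,y_t)\in C([0,\infty);\mathcal H_0)$, $\int_0^tU\,ds\in D(\mathcal A)$ and $U(t)=U(0)+\mathcal A\int_0^tU\,ds$ for all $t\ge0$. It is classical if $y\in C^2([0,\infty);L^2_{1/a})\cap C^1([0,\infty);H^2_{1/a})\cap C([0,\infty);D(A))$ and $y_{tt}+Ay=0$ for all $t\ge 0$. The energy is $E_y(t)=\frac12\int_0^1\big(\frac{y_t^2(t,x)}{a(x)}+y_{xx}^2(t,x)\big)dx$. Let $y$ be a mild solution and $T>0$. Then there is a unique $g\in L^2(0,T)$ which is the boundary trace $y_{xx}(\cdot,1)$ of $y$ in the following sense: there are sequences of classical solutions $y^n$ with $(y^n(0),y^n_t(0))\to(y(0),y_t(0))$ in $\mathcal H_0$, and for every such sequence the functions $y^n_{xx}(\cdot,1)$ belong to $L^2(0,T)$ and converge to $g$ in $L^2(0,T)$. If $y$ is classical, then $g(t)=y_{xx}(t,1)$ for almost every $t\in(0,T)$.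 Writing $y_{xx}(\cdot,1)=g$, one has $$\int_0^T y_{xx}^2(t,1)\,dt\le\Big(12T+4\max\Big\{\frac4{a(1)},1\Big\}\Big)E_y(0).$$ -/

import Mathlib

open MeasureTheory Set Filter Topology
open scoped ContDiff

noncomputable section

namespace DegenerateBeam

/-- `K` is the supremum of `x |a'(x)| / a(x)` over `(0, 1]` (in particular this supremum is finite).
At `x = 1` the derivative is the one-sided one. -/
def IsDegeneracyConstant (a : ℝ → ℝ) (K : ℝ) : Prop :=
  IsLUB ((fun x => x * |derivWithin a (Ioc 0 1) x| / a x) '' Ioc (0 : ℝ) 1) K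

/-- `a` is weakly degenerate at `0`. Only the values of `a` on `[0, 1]` matter. -/
structure WeaklyDegenerate (a : ℝ → ℝ) : Prop where
  continuousOn : ContinuousOn a (Icc 0 1)
  contDiffOn : ContDiffOn ℝ 1 a (Ioc 0 1)
  zero : a 0 = 0
  pos : ∀ x ∈ Ioc (0 : ℝ) 1, 0 < a x
  constant : ∃ K ∈ Ioo (0 : ℝ) 1, IsDegeneracyConstant a K

/-- `a` is strongly degenerate at `0`. -/
structure StronglyDegenerate (a : ℝ → ℝ) : Prop where
  contDiffOn : ContDiffOn ℝ 1 a (Icc 0 1)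
  zero : a 0 = 0
  pos : ∀ x ∈ Ioc (0 : ℝ) 1, 0 < a x
  constant : ∃ K ∈ Ico (1 : ℝ) 2, IsDegeneracyConstant a K

/-- `g` is the weak (distributional) derivative of order `n` of `f` on the interval `(0, 1)`. -/
def HasWeakDeriv (n : ℕ) (f g : ℝ → ℝ) : Prop :=
  LocallyIntegrableOn f (Ioo 0 1) ∧ LocallyIntegrableOn g (Ioo 0 1) ∧
    ∀ φ : ℝ → ℝ, ContDiff ℝ ∞ φ → HasCompactSupport φ → tsupport φ ⊆ Ioo 0 1 →
      ∫ x in Ioo (0 : ℝ) 1, f x * iteratedDeriv n φ x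
        = (-1) ^ n * ∫ x in Ioo (0 : ℝ) 1, g x * φ x

/-- The space `L²(0, 1)`. -/
abbrev L2 : Type := Lp ℝ 2 (volume.restrict (Ioo (0 : ℝ) 1))

/-- The measure `dx / a(x)` on `(0, 1)`. -/
def weightedMeasure (a : ℝ → ℝ) : Measure ℝ :=
  (volume.restrict (Ioo 0 1)).withDensity fun x => ENNReal.ofReal (1 / a x)

/-- The weighted space `L²_{1/a}(0, 1)`, with squared norm `∫₀¹ u² / a`. -/
abbrev L2w (a : ℝ → ℝ) : Type := Lp ℝ 2 (weightedMeasure a)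

/-- `(u, u', u'')` are the components of an element of `H²_{1/a}(0, 1) = L²_{1/a} ∩ H²₀(0, 1)`:
`w` and `w'` are the continuous representatives of `u` and `u'`, which vanish at `0` and `1`. -/
def IsH2Triple (a : ℝ → ℝ) (u : L2w a) (u' u'' : L2) : Prop :=
  ∃ w w' : ℝ → ℝ,
    ContinuousOn w (Icc 0 1) ∧ ContinuousOn w' (Icc 0 1) ∧
    w 0 = 0 ∧ w 1 = 0 ∧ w' 0 = 0 ∧ w' 1 = 0 ∧
    u =ᵐ[weightedMeasure a] w ∧ u' =ᵐ[volume.restrict (Ioo (0 : ℝ) 1)] w' ∧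
    HasWeakDeriv 1 w w' ∧ HasWeakDeriv 1 w' u''

theorem HasWeakDeriv.congr_right {n : ℕ} {f g h : ℝ → ℝ} (hf : HasWeakDeriv n f g)
    (hgh : g =ᵐ[volume.restrict (Ioo (0 : ℝ) 1)] h) : HasWeakDeriv n f h := by
  obtain ⟨h1, h2, h3⟩ := hf
  refine ⟨h1, ?_, fun φ hφ hc hs => ?_⟩
  · rw [locallyIntegrableOn_iff isOpen_Ioo.isLocallyClosed] at h2 ⊢
    exact fun k hk hkc => (h2 k hk hkc).congr_fun_ae (ae_restrict_of_ae_restrict_of_subset hk hgh)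
  · rw [h3 φ hφ hc hs]
    congr 1
    exact integral_congr_ae (hgh.mono fun x hx => by simp only [hx])

theorem integrableOn_mul_of_test {f φ : ℝ → ℝ} (hf : LocallyIntegrableOn f (Ioo 0 1))
    (hφ : Continuous φ) (hc : HasCompactSupport φ) (hs : tsupport φ ⊆ Ioo 0 1) :
    Integrable (fun x => f x * φ x) (volume.restrict (Ioo 0 1)) := by
  have h1 : IntegrableOn f (tsupport φ) := hf.integrableOn_compact_subset hs hc
  have h2 : IntegrableOn (fun x => f x * φ x) (tsupport φ) := by
    exact h1.mul_continuousOn hφ.continuousOn hc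
  have h3 : Integrable (fun x => f x * φ x) := by
    refine (integrableOn_iff_integrable_of_support_subset ?_).1 h2
    intro x hx
    exact subset_tsupport φ (fun h0 => hx (by simp [h0]))
  exact h3.integrableOn

theorem integrableOn_mul_iteratedDeriv {f φ : ℝ → ℝ} (n : ℕ)
    (hf : LocallyIntegrableOn f (Ioo 0 1))
    (hφ : ContDiff ℝ ∞ φ) (hc : HasCompactSupport φ) (hs : tsupport φ ⊆ Ioo 0 1) :
    Integrable (fun x => f x * iteratedDeriv n φ x) (volume.restrict (Ioo 0 1)) := by
  have hsub : tsupport (iteratedDeriv n φ) ⊆ tsupport φ := by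
    refine closure_minimal (fun x hx => ?_) (isClosed_tsupport φ)
    refine support_iteratedFDeriv_subset (𝕜 := ℝ) n (fun h0 => hx ?_)
    simp [iteratedDeriv, h0]
  refine integrableOn_mul_of_test hf ?_ ?_ (hsub.trans hs)
  · exact hφ.continuous_iteratedDeriv n (by exact_mod_cast le_top)
  · exact hc.of_isClosed_subset (isClosed_tsupport _) hsub

theorem HasWeakDeriv.add {n : ℕ} {f g f₂ g₂ : ℝ → ℝ} (h : HasWeakDeriv n f g)
    (h₂ : HasWeakDeriv n f₂ g₂) : HasWeakDeriv n (f + f₂) (g + g₂) := by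
  refine ⟨h.1.add h₂.1, h.2.1.add h₂.2.1, fun φ hφ hc hs => ?_⟩
  simp only [Pi.add_apply, add_mul]
  rw [integral_add (integrableOn_mul_iteratedDeriv n h.1 hφ hc hs)
      (integrableOn_mul_iteratedDeriv n h₂.1 hφ hc hs),
    integral_add (integrableOn_mul_of_test h.2.1 hφ.continuous hc hs)
      (integrableOn_mul_of_test h₂.2.1 hφ.continuous hc hs),
    h.2.2 φ hφ hc hs, h₂.2.2 φ hφ hc hs, mul_add]

theorem HasWeakDeriv.smul {n : ℕ} {f g : ℝ → ℝ} (c : ℝ) (h : HasWeakDeriv n f g) :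
    HasWeakDeriv n (c • f) (c • g) := by
  refine ⟨h.1.smul c, h.2.1.smul c, fun φ hφ hc hs => ?_⟩
  simp only [Pi.smul_apply, smul_eq_mul, mul_assoc]
  rw [integral_const_mul, integral_const_mul, h.2.2 φ hφ hc hs]
  ring

theorem HasWeakDeriv.zero (n : ℕ) : HasWeakDeriv n 0 0 :=
  ⟨locallyIntegrableOn_zero, locallyIntegrableOn_zero, fun φ _ _ _ => by simp⟩

/-- The Hilbert space `H²_{1/a}(0, 1)`, an element `u` being stored as the triple `(u, u', u'')`,
in which `u` determines `u'` and `u''`; the squared norm is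
`‖u‖²_{L²_{1/a}} + ‖u'‖²_{L²} + ‖u''‖²_{L²}`. -/
def H2w (a : ℝ → ℝ) : Submodule ℝ (WithLp 2 (L2w a × WithLp 2 (L2 × L2))) where
  carrier := {p | IsH2Triple a p.fst p.snd.fst p.snd.snd}
  add_mem' := by
    rintro p q ⟨w, w', h1, h2, h3, h4, h5, h6, h7, h8, h9, h10⟩
      ⟨z, z', k1, k2, k3, k4, k5, k6, k7, k8, k9, k10⟩
    refine ⟨w + z, w' + z', h1.add k1, h2.add k2, by simp [*], by simp [*], by simp [*],
      by simp [*], ?_, ?_, h9.add k9, (h10.add k10).congr_right ?_⟩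
    · exact (Lp.coeFn_add _ _).trans (h7.add k7)
    · exact (Lp.coeFn_add _ _).trans (h8.add k8)
    · exact (Lp.coeFn_add _ _).symm
  zero_mem' := by
    refine ⟨0, 0, continuousOn_const, continuousOn_const, rfl, rfl, rfl, rfl, ?_, ?_,
      HasWeakDeriv.zero 1, (HasWeakDeriv.zero 1).congr_right ?_⟩
    · exact Lp.coeFn_zero _ _ _
    · exact Lp.coeFn_zero _ _ _
    · exact (Lp.coeFn_zero _ _ _).symm
  smul_mem' := by
    rintro c p ⟨w, w', h1, h2, h3, h4, h5, h6, h7, h8, h9, h10⟩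
    refine ⟨c • w, c • w', h1.const_smul c, h2.const_smul c, by simp [*], by simp [*],
      by simp [*], by simp [*], ?_, ?_, h9.smul c, (h10.smul c).congr_right ?_⟩
    · exact (Lp.coeFn_smul _ _).trans (h7.const_smul c)
    · exact (Lp.coeFn_smul _ _).trans (h8.const_smul c)
    · exact (Lp.coeFn_smul _ _).symm

/-- The inclusion of `H²_{1/a}(0, 1)` in `L²_{1/a}(0, 1)`. -/
def toL2w {a : ℝ → ℝ} (u : H2w a) : L2w a := u.1.fst

/-- The second derivative `u''` of `u ∈ H²_{1/a}(0, 1)`. -/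
def d2 {a : ℝ → ℝ} (u : H2w a) : L2 := u.1.snd.snd

/-- `u ∈ D(A)` and `A u = f`, that is, `u ∈ H²_{1/a}(0, 1)` and `a u'''' = f ∈ L²_{1/a}(0, 1)`. -/
def IsA (a : ℝ → ℝ) (u : H2w a) (f : L2w a) : Prop :=
  ∃ w : ℝ → ℝ, HasWeakDeriv 4 (toL2w u) w ∧ f =ᵐ[weightedMeasure a] fun x => a x * w x

/-- The squared norm of `(u, v)` in `ℋ₀ = H²_{1/a}(0, 1) × L²_{1/a}(0, 1)`. -/
def normSqH0 {a : ℝ → ℝ} (u : H2w a) (v : L2w a) : ℝ :=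
  (∫ x in Ioo (0 : ℝ) 1, d2 u x ^ 2) + ∫ x in Ioo (0 : ℝ) 1, v x ^ 2 / a x

/-- The energy `½ ∫₀¹ (v² / a + u_{xx}²) dx` of a state `(u, v) ∈ ℋ₀`; the energy at time `t` of a
solution `y` is the energy of `(y(t), y_t(t))`. -/
def energy {a : ℝ → ℝ} (u : H2w a) (v : L2w a) : ℝ :=
  1 / 2 * ∫ x in Ioo (0 : ℝ) 1, (v x ^ 2 / a x + d2 u x ^ 2)

/-- `y` is a mild solution on `[0, ∞)` of `y_tt + A y = 0` with clamped ends, with velocity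
`y_t = v`, for the initial data `(y 0, v 0) ∈ ℋ₀`: the function `U = (y, v)` is continuous with
values in `ℋ₀`, `∫₀ᵗ U` belongs to the domain of `𝒜 = (0, Id; -A, 0)`, and
`U(t) = U(0) + 𝒜 ∫₀ᵗ U` for all `t ≥ 0`. The first line of the system is `y_t = v`; in the second
line `Y = ∫₀ᵗ y ds`. -/
structure IsMildSolution (a : ℝ → ℝ) (y : ℝ → H2w a) (v : ℝ → L2w a) : Prop where
  continuousOn : ContinuousOn y (Ici 0)
  continuousOn_vel : ContinuousOn v (Ici 0)
  vel : ∀ t ∈ Ici (0 : ℝ), HasDerivWithinAt (fun s => toL2w (y s)) (v t) (Ici 0) t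
  eqn : ∀ t ∈ Ici (0 : ℝ), ∃ Y : H2w a,
    toL2w Y = (∫ s in (0 : ℝ)..t, toL2w (y s)) ∧ IsA a Y (v 0 - v t)

/-- `y` is a classical solution, with velocity `y_t = v`:
`y ∈ C²([0, ∞); L²_{1/a}) ∩ C¹([0, ∞); H²_{1/a}) ∩ C([0, ∞); D(A))` and `y_tt(t) + A y(t) = 0` for
all `t ≥ 0`. Here `w` is the velocity as an element of `H²_{1/a}` and `f = A y`. -/
def IsClassicalSolution (a : ℝ → ℝ) (y : ℝ → H2w a) (v : ℝ → L2w a) : Prop :=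
  ∃ (w : ℝ → H2w a) (f : ℝ → L2w a),
    ContinuousOn w (Ici 0) ∧ ContinuousOn f (Ici 0) ∧
    ∀ t ∈ Ici (0 : ℝ),
      HasDerivWithinAt y (w t) (Ici 0) t ∧ toL2w (w t) = v t ∧
      HasDerivWithinAt v (-f t) (Ici 0) t ∧ IsA a (y t) (f t)

/-- `u''(1) = c`: the second derivative of `u` has a representative that is continuous on `(0, 1]`
and takes the value `c` at `1`. -/
def HasSecondDerivAtOne {a : ℝ → ℝ} (u : H2w a) (c : ℝ) : Prop :=
  ∃ w : ℝ → ℝ, ContinuousOn w (Ioc 0 1) ∧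
    d2 u =ᵐ[volume.restrict (Ioo (0 : ℝ) 1)] w ∧ w 1 = c

/-- `(yₙ)` is a sequence of classical solutions whose initial data converge in `ℋ₀` to those of
`y`. -/
def IsApproximation (a : ℝ → ℝ) (y : ℝ → H2w a) (v : ℝ → L2w a)
    (yn : ℕ → ℝ → H2w a) (vn : ℕ → ℝ → L2w a) : Prop :=
  (∀ n, IsClassicalSolution a (yn n) (vn n)) ∧
    Tendsto (fun n => normSqH0 (yn n 0 - y 0) (vn n 0 - v 0)) atTop (𝓝 0)

/-- `g ∈ L²(0, T)` is the boundary trace `y_{xx}(·, 1)` of the (mild) solution `y`: approximations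
of `y` by classical solutions exist, and for each of them the traces `(yₙ)_{xx}(·, 1)` lie in
`L²(0, T)` and converge to `g` there. -/
def IsBoundaryTrace (a : ℝ → ℝ) (y : ℝ → H2w a) (v : ℝ → L2w a) (T : ℝ)
    (g : Lp ℝ 2 (volume.restrict (Ioo 0 T))) : Prop :=
  (∃ yn vn, IsApproximation a y v yn vn) ∧
    ∀ yn vn, IsApproximation a y v yn vn →
      ∃ gn : ℕ → Lp ℝ 2 (volume.restrict (Ioo 0 T)),
        (∀ n, ∀ᵐ t ∂(volume.restrict (Ioo 0 T)), HasSecondDerivAtOne (yn n t) (gn n t)) ∧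
        Tendsto gn atTop (𝓝 g)

end DegenerateBeam

end

/-!
The trace estimate is a multiplier argument. For a classical solution test `y_tt / a + y_xxxx = 0`
with `x² y_x`. Writing `G(t) = ∫ (x² / a) y_t y_x`, integration by parts gives
`½ y_xx(t, 1)² = G'(t) + ½ ∫ (x² / a)' y_t² + 3 ∫ x y_xx²`. Both kinds of degeneracy imply
`x |a'| ≤ 2 a`, hence `0 ≤ (x² / a)' ≤ 4 / a` and `x² / a ≤ 1 / a(1)`. So the last two terms are at
most `6 E` and `|G| ≤ max (4 / a(1), 1) E`, and since the energy `E` is conserved, integrating over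
`(0, T)` gives the bound (`IsClassicalSolution.exists_trace`).

The integrations by parts have to be justified at the degenerate end `0`. For `u ∈ D(A)` with
`W = u'''' = A u / a`, the function `x W` is square integrable because `x² / a` is bounded. Hence
`R(x) = ∫ₓ¹ W` is integrable, `P(x) = ∫ₓ¹ R` is continuous on `[0, 1]`, and `u'' - P` is affine
because its second weak derivative vanishes. Two applications of Fubini's theorem then yield Green's
formula, without boundary terms at `0` (`IsA.exists_green`). With `φ ∈ H²₀` it gives the conservation
of energy; with `φ = x³ - x²` it exhibits `u''(1)` as a bounded functional of `(u'', A u)`, so that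
the trace of a classical solution is continuous in time; and with `φ = x² u'` it gives the multiplier
identity.

Approximations of a mild solution are its time means `h⁻¹ ∫ₜ^(t+h) y`, which are classical solutions
(`IsMildSolution.isClassicalSolution_timeMean`); this needs no semigroup, only that
`H²_{1/a}(0, 1)` is complete. Applied to differences, the estimate shows that the traces of any
approximating sequence converge in `L²(0, T)`, to a limit independent of the sequence, which inherits
the bound.
-/

noncomputable section

namespace DegenerateBeam

/-! ### Test functions, the lemma of du Bois-Reymond, and Fubini on a triangle -/

/-- `φ` is a test function on `(0, 1)`: smooth, with compact support in `(0, 1)`. -/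
structure IsTest (φ : ℝ → ℝ) : Prop where
  contDiff : ContDiff ℝ ∞ φ
  hasCompactSupport : HasCompactSupport φ
  tsupport_subset : tsupport φ ⊆ Ioo 0 1

theorem IsTest.continuous {φ : ℝ → ℝ} (h : IsTest φ) : Continuous φ := h.contDiff.continuous

theorem IsTest.deriv {φ : ℝ → ℝ} (h : IsTest φ) : IsTest (deriv φ) where
  contDiff := (contDiff_infty_iff_deriv.1 h.contDiff).2
  hasCompactSupport := h.hasCompactSupport.deriv
  tsupport_subset := tsupport_deriv_subset.trans h.tsupport_subset

theorem IsTest.hasDerivAt {φ : ℝ → ℝ} (h : IsTest φ) (x : ℝ) : HasDerivAt φ (_root_.deriv φ x) x :=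
  ((contDiff_infty_iff_deriv.1 h.contDiff).1 x).hasDerivAt

theorem IsTest.eq_zero {φ : ℝ → ℝ} (h : IsTest φ) {x : ℝ} (hx : x ∉ Ioo (0 : ℝ) 1) : φ x = 0 :=
  image_eq_zero_of_notMem_tsupport fun h' => hx (h.tsupport_subset h')

theorem IsTest.map_zero {φ : ℝ → ℝ} (h : IsTest φ) : φ 0 = 0 := h.eq_zero (by simp)

theorem IsTest.map_one {φ : ℝ → ℝ} (h : IsTest φ) : φ 1 = 0 := h.eq_zero (by simp)

theorem IsTest.sub {φ ψ : ℝ → ℝ} (h : IsTest φ) (h' : IsTest ψ) :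
    IsTest (fun x => φ x - ψ x) where
  contDiff := h.contDiff.sub h'.contDiff
  hasCompactSupport := h.hasCompactSupport.sub h'.hasCompactSupport
  tsupport_subset := (tsupport_sub φ ψ).trans (union_subset h.tsupport_subset h'.tsupport_subset)

theorem IsTest.const_mul {φ : ℝ → ℝ} (c : ℝ) (h : IsTest φ) : IsTest (fun x => c * φ x) where
  contDiff := contDiff_const.mul h.contDiff
  hasCompactSupport := h.hasCompactSupport.mul_left
  tsupport_subset := (tsupport_mul_subset_right (f := fun _ => c) (g := φ)).trans h.tsupport_subset

theorem IsTest.eq_primitive_deriv {φ : ℝ → ℝ} (h : IsTest φ) (x : ℝ) :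
    ∫ s in (0 : ℝ)..x, _root_.deriv φ s = φ x := by
  rw [intervalIntegral.integral_eq_sub_of_hasDerivAt (fun s _ => h.hasDerivAt s)
    (h.deriv.continuous.intervalIntegrable _ _), h.map_zero, sub_zero]

/-- A test function of mean zero is the derivative of a test function. -/
theorem IsTest.exists_primitive {η : ℝ → ℝ} (h : IsTest η) (h0 : ∫ x in (0 : ℝ)..1, η x = 0) :
    ∃ φ, IsTest φ ∧ _root_.deriv φ = η := by
  have hd : ∀ x, HasDerivAt (fun x => ∫ s in (0 : ℝ)..x, η s) (η x) x := fun x =>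
    intervalIntegral.integral_hasDerivAt_right (h.continuous.intervalIntegrable _ _)
      h.continuous.stronglyMeasurable.stronglyMeasurableAtFilter h.continuous.continuousAt
  have hderiv : _root_.deriv (fun x => ∫ s in (0 : ℝ)..x, η s) = η := funext fun x => (hd x).deriv
  obtain ⟨α, β, hα, hβ, hsub⟩ : ∃ α β : ℝ, 0 < α ∧ β < 1 ∧ tsupport η ⊆ Icc α β := by
    rcases (tsupport η).eq_empty_or_nonempty with he | hne
    · exact ⟨1 / 2, 1 / 2, by norm_num, by norm_num, by simp [he]⟩
    · have hc : IsCompact (tsupport η) := h.hasCompactSupport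
      obtain ⟨α, hα⟩ := hc.exists_isLeast hne
      obtain ⟨β, hβ⟩ := hc.exists_isGreatest hne
      exact ⟨α, β, (h.tsupport_subset hα.1).1, (h.tsupport_subset hβ.1).2,
        fun x hx => ⟨hα.2 hx, hβ.2 hx⟩⟩
  have hz : ∀ x, x ∉ Icc α β → η x = 0 := fun x hx =>
    image_eq_zero_of_notMem_tsupport fun h' => hx (hsub h')
  have hsupp : Function.support (fun x => ∫ s in (0 : ℝ)..x, η s) ⊆ Icc α β := by
    intro x hx
    by_contra hn
    apply hx
    rcases lt_or_ge x α with hxα | hxα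
    · have : ∫ s in (0 : ℝ)..x, η s = ∫ s in (0 : ℝ)..x, (0 : ℝ) := by
        refine intervalIntegral.integral_congr fun s hs => hz s fun hs' => ?_
        rcases le_total 0 x with h1 | h1
        · rw [uIcc_of_le h1] at hs; linarith [hs.2, hs'.1]
        · rw [uIcc_of_ge h1] at hs; linarith [hs.2, hs'.1]
      simpa using this
    · have hxβ : β < x := by
        by_contra h'
        exact hn ⟨hxα, not_lt.1 h'⟩
      have h1 : ∫ s in x..1, η s = ∫ s in x..1, (0 : ℝ) := by
        refine intervalIntegral.integral_congr fun s hs => hz s fun hs' => ?_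
        rcases le_total x 1 with h1 | h1
        · rw [uIcc_of_le h1] at hs; linarith [hs.1, hs'.2]
        · rw [uIcc_of_ge h1] at hs; linarith [hs.1, hs'.2]
      have h2 := intervalIntegral.integral_add_adjacent_intervals
        (h.continuous.intervalIntegrable (μ := volume) 0 x)
        (h.continuous.intervalIntegrable (μ := volume) x 1)
      rw [h0, h1] at h2
      simpa using h2
  refine ⟨fun x => ∫ s in (0 : ℝ)..x, η s, ⟨?_, ?_, ?_⟩, hderiv⟩
  · exact contDiff_infty_iff_deriv.2 ⟨fun x => (hd x).differentiableAt, hderiv.symm ▸ h.contDiff⟩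
  · exact HasCompactSupport.of_support_subset_isCompact isCompact_Icc hsupp
  · exact (closure_minimal hsupp isClosed_Icc).trans fun x hx =>
      ⟨hα.trans_le hx.1, hx.2.trans_lt hβ⟩

theorem exists_isTest_integral_eq_one : ∃ ρ, IsTest ρ ∧ ∫ x in (0 : ℝ)..1, ρ x = 1 := by
  let b : ContDiffBump (1 / 2 : ℝ) := ⟨1 / 8, 1 / 4, by norm_num, by norm_num⟩
  have hb : IsTest b := by
    refine ⟨b.contDiff, b.hasCompactSupport, ?_⟩
    rw [b.tsupport_eq, Real.closedBall_eq_Icc]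
    intro x hx
    constructor <;> norm_num [b] at hx ⊢ <;> linarith [hx.1, hx.2]
  have hpos : 0 < ∫ x in (0 : ℝ)..1, b x := by
    have h1 : (∫ x in (0 : ℝ)..1, b x) = ∫ x, b x := by
      rw [intervalIntegral.integral_of_le zero_le_one, integral_Ioc_eq_integral_Ioo]
      exact setIntegral_eq_integral_of_forall_compl_eq_zero fun x hx => hb.eq_zero hx
    rw [h1]
    exact b.integral_pos
  refine ⟨_, hb.const_mul (∫ x in (0 : ℝ)..1, b x)⁻¹, ?_⟩
  rw [intervalIntegral.integral_const_mul, inv_mul_cancel₀ hpos.ne']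

theorem integral_Ioo_eq_intervalIntegral (f : ℝ → ℝ) :
    ∫ x in Ioo (0 : ℝ) 1, f x = ∫ x in (0 : ℝ)..1, f x := by
  rw [intervalIntegral.integral_of_le zero_le_one, integral_Ioc_eq_integral_Ioo]

theorem integrableOn_mul_isTest {f φ : ℝ → ℝ} (hf : IntegrableOn f (Ioo 0 1)) (hφ : IsTest φ) :
    IntegrableOn (fun x => f x * φ x) (Ioo 0 1) :=
  integrableOn_mul_of_test hf.locallyIntegrableOn hφ.continuous hφ.hasCompactSupport
    hφ.tsupport_subset

/-- The lemma of du Bois-Reymond: a function with vanishing weak derivative is constant. -/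
theorem ae_const_of_integral_mul_deriv_eq_zero {h : ℝ → ℝ} (hh : IntegrableOn h (Ioo 0 1))
    (h0 : ∀ φ, IsTest φ → ∫ x in Ioo (0 : ℝ) 1, h x * deriv φ x = 0) :
    ∃ c, ∀ᵐ x ∂volume.restrict (Ioo (0 : ℝ) 1), h x = c := by
  obtain ⟨ρ, hρ, hρ1⟩ := exists_isTest_integral_eq_one
  refine ⟨∫ x in Ioo (0 : ℝ) 1, h x * ρ x, ?_⟩
  set κ := ∫ x in Ioo (0 : ℝ) 1, h x * ρ x with hκ
  have hint : IntegrableOn (fun x => h x - κ) (Ioo 0 1) := hh.sub (integrable_const _)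
  have key := isOpen_Ioo.ae_eq_zero_of_integral_contDiff_smul_eq_zero (μ := volume)
    (f := fun x => h x - κ) hint.locallyIntegrableOn ?_
  · rw [ae_restrict_iff' measurableSet_Ioo]
    filter_upwards [key] with x hx hx'
    linarith [hx hx']
  · intro η h1 h2 h3
    have hη : IsTest η := ⟨h1, h2, h3⟩
    obtain ⟨φ, hφ, hφ'⟩ := (hη.sub (hρ.const_mul (∫ x in (0 : ℝ)..1, η x))).exists_primitive (by
      rw [intervalIntegral.integral_sub (hη.continuous.intervalIntegrable _ _)
        ((hρ.const_mul _).continuous.intervalIntegrable _ _),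
        intervalIntegral.integral_const_mul, hρ1]
      ring)
    have h4 := h0 φ hφ
    rw [hφ'] at h4
    have h5 : ∫ x, η x • (h x - κ) = ∫ x in Ioo (0 : ℝ) 1, (h x - κ) * η x := by
      rw [← setIntegral_eq_integral_of_forall_compl_eq_zero (s := Ioo (0 : ℝ) 1)
        (fun x hx => by simp [hη.eq_zero hx])]
      simp only [smul_eq_mul, mul_comm]
    have e1 := integrableOn_mul_isTest hh hη
    have e2 := (integrableOn_mul_isTest hh hρ).const_mul (∫ x in (0 : ℝ)..1, η x)
    have e3 : IntegrableOn η (Ioo 0 1) := by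
      simpa using integrableOn_mul_isTest (f := fun _ => 1) (integrable_const _) hη
    have h6 : ∫ x in Ioo (0 : ℝ) 1, h x * (η x - (∫ x in (0 : ℝ)..1, η x) * ρ x)
        = (∫ x in Ioo (0 : ℝ) 1, h x * η x) - (∫ x in (0 : ℝ)..1, η x) * κ := by
      rw [hκ, ← integral_const_mul, ← integral_sub e1 e2]
      congr 1; ext x; ring
    have h7 : ∫ x in Ioo (0 : ℝ) 1, (h x - κ) * η x
        = (∫ x in Ioo (0 : ℝ) 1, h x * η x) - κ * ∫ x in (0 : ℝ)..1, η x := by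
      rw [← integral_Ioo_eq_intervalIntegral, ← integral_const_mul,
        ← integral_sub e1 (e3.const_mul κ)]
      congr 1; ext x; ring
    rw [h5, h7]
    linarith

/-- A function with vanishing second weak derivative is affine. -/
theorem ae_affine_of_integral_mul_deriv_deriv_eq_zero {h : ℝ → ℝ} (hh : IntegrableOn h (Ioo 0 1))
    (h0 : ∀ φ, IsTest φ → ∫ x in Ioo (0 : ℝ) 1, h x * deriv (deriv φ) x = 0) :
    ∃ c d, ∀ᵐ x ∂volume.restrict (Ioo (0 : ℝ) 1), h x = c + d * x := by
  obtain ⟨ρ, hρ, hρ1⟩ := exists_isTest_integral_eq_one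
  set κ := ∫ x in Ioo (0 : ℝ) 1, h x * deriv ρ x with hκ
  have hx : IntegrableOn (fun x : ℝ => κ * x) (Ioo 0 1) :=
    ((by fun_prop : Continuous fun x : ℝ => κ * x).integrableOn_Icc (a := 0) (b := 1)).mono_set
      Ioo_subset_Icc_self
  obtain ⟨c, hc⟩ := ae_const_of_integral_mul_deriv_eq_zero (h := fun x => h x + κ * x)
    (hh.add hx) (by
    intro η hη
    set J := ∫ x in (0 : ℝ)..1, η x with hJ
    obtain ⟨φ, hφ, hφ'⟩ := (hη.sub (hρ.const_mul J)).exists_primitive (by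
      rw [intervalIntegral.integral_sub (hη.continuous.intervalIntegrable _ _)
        ((hρ.const_mul _).continuous.intervalIntegrable _ _),
        intervalIntegral.integral_const_mul, hρ1]
      ring)
    have h4 := h0 φ hφ
    have h5 : deriv (deriv φ) = fun x => deriv η x - J * deriv ρ x := by
      rw [hφ']; ext x
      exact ((hη.hasDerivAt x).sub ((hρ.hasDerivAt x).const_mul J)).deriv
    rw [h5] at h4
    have e1 := integrableOn_mul_isTest hh hη.deriv
    have e2 := (integrableOn_mul_isTest hh hρ.deriv).const_mul J
    have e3 := integrableOn_mul_isTest hx hη.deriv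
    have h6 : ∫ x in Ioo (0 : ℝ) 1, h x * (deriv η x - J * deriv ρ x)
        = (∫ x in Ioo (0 : ℝ) 1, h x * deriv η x) - J * κ := by
      rw [hκ, ← integral_const_mul, ← integral_sub e1 e2]
      congr 1; ext x; ring
    have h7 : ∫ x in Ioo (0 : ℝ) 1, κ * x * deriv η x = - (κ * J) := by
      rw [integral_Ioo_eq_intervalIntegral]
      have := intervalIntegral.integral_mul_deriv_eq_deriv_mul (a := 0) (b := 1)
        (u := fun x => κ * x) (u' := fun _ => κ) (v := η) (v' := deriv η)
        (fun x _ => by simpa using (hasDerivAt_id x).const_mul κ) (fun x _ => hη.hasDerivAt x)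
        (by simp) (hη.deriv.continuous.intervalIntegrable _ _)
      rw [this, intervalIntegral.integral_const_mul, hη.map_one, hη.map_zero]
      ring
    have h8 : ∫ x in Ioo (0 : ℝ) 1, (h x + κ * x) * deriv η x
      = (∫ x in Ioo (0 : ℝ) 1, h x * deriv η x) + ∫ x in Ioo (0 : ℝ) 1, κ * x * deriv η x := by
      rw [← integral_add e1 e3]
      congr 1; ext x; ring
    rw [h8, h7]
    linarith)
  refine ⟨c, -κ, hc.mono fun x hx => ?_⟩
  linarith

theorem intervalIntegral_eq_integral_indicator (g : ℝ → ℝ) {x : ℝ} (hx : x ∈ Ioo (0 : ℝ) 1) :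
    ∫ s in (0 : ℝ)..x, g s = ∫ s in Ioo (0 : ℝ) 1, (Iio x).indicator g s := by
  rw [setIntegral_indicator measurableSet_Iio, intervalIntegral.integral_of_le hx.1.le,
    integral_Ioc_eq_integral_Ioo, Ioo_inter_Iio, min_eq_right hx.2.le]

theorem intervalIntegral_eq_integral_indicator' (g : ℝ → ℝ) {x : ℝ} (hx : x ∈ Ioo (0 : ℝ) 1) :
    ∫ s in x..1, g s = ∫ s in Ioo (0 : ℝ) 1, (Ioi x).indicator g s := by
  rw [setIntegral_indicator measurableSet_Ioi, intervalIntegral.integral_of_le hx.2.le,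
    integral_Ioc_eq_integral_Ioo, Ioo_inter_Ioi, max_eq_right hx.1.le]

/-- Fubini's theorem on the triangle `0 < s < x < 1`. -/
theorem integral_mul_primitive_of_integrable {f g : ℝ → ℝ}
    (h : Integrable ({z : ℝ × ℝ | z.2 < z.1}.indicator fun z => f z.1 * g z.2)
      ((volume.restrict (Ioo (0 : ℝ) 1)).prod (volume.restrict (Ioo (0 : ℝ) 1)))) :
    ∫ x in Ioo (0 : ℝ) 1, f x * ∫ s in (0 : ℝ)..x, g s
      = ∫ s in Ioo (0 : ℝ) 1, g s * ∫ x in s..1, f x := by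
  have h1 : ∫ x in Ioo (0 : ℝ) 1, f x * ∫ s in (0 : ℝ)..x, g s
      = ∫ x in Ioo (0 : ℝ) 1, ∫ s in Ioo (0 : ℝ) 1,
        {z : ℝ × ℝ | z.2 < z.1}.indicator (fun z => f z.1 * g z.2) (x, s) := by
    refine setIntegral_congr_fun measurableSet_Ioo fun x hx => ?_
    rw [intervalIntegral_eq_integral_indicator g hx, ← integral_const_mul]
    congr 1; ext s
    by_cases hs : s < x <;> simp [indicator, hs]
  have h2 : ∫ s in Ioo (0 : ℝ) 1, g s * ∫ x in s..1, f x
      = ∫ s in Ioo (0 : ℝ) 1, ∫ x in Ioo (0 : ℝ) 1,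
        {z : ℝ × ℝ | z.2 < z.1}.indicator (fun z => f z.1 * g z.2) (x, s) := by
    refine setIntegral_congr_fun measurableSet_Ioo fun x hx => ?_
    rw [intervalIntegral_eq_integral_indicator' f hx, ← integral_const_mul]
    congr 1; ext s
    by_cases hs : x < s <;> simp [indicator, hs, mul_comm]
  rw [h1, h2, integral_integral_swap]
  exact h

theorem integral_mul_primitive {f g : ℝ → ℝ} (hf : IntegrableOn f (Ioo 0 1))
    (hg : IntegrableOn g (Ioo 0 1)) :
    ∫ x in Ioo (0 : ℝ) 1, f x * ∫ s in (0 : ℝ)..x, g s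
      = ∫ s in Ioo (0 : ℝ) 1, g s * ∫ x in s..1, f x :=
  integral_mul_primitive_of_integrable
    ((Integrable.mul_prod hf hg).indicator (measurableSet_lt measurable_snd measurable_fst))

/-- On the triangle `s < x`, the singularity of `f` at `0` is compensated by the length of the
slices, so that integrability of `x f(x)` suffices when `g` is bounded. -/
theorem integrable_triangle_of_bounded {f g : ℝ → ℝ} {C : ℝ}
    (hfm : AEStronglyMeasurable f (volume.restrict (Ioo (0 : ℝ) 1)))
    (hf : IntegrableOn (fun x => x * f x) (Ioo 0 1))
    (hgm : AEStronglyMeasurable g (volume.restrict (Ioo (0 : ℝ) 1)))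
    (hg : ∀ x ∈ Ioo (0 : ℝ) 1, |g x| ≤ C) :
    Integrable ({z : ℝ × ℝ | z.2 < z.1}.indicator fun z => f z.1 * g z.2)
      ((volume.restrict (Ioo (0 : ℝ) 1)).prod (volume.restrict (Ioo (0 : ℝ) 1))) := by
  have hgi : IntegrableOn g (Ioo 0 1) := by
    refine Integrable.of_bound hgm C ?_
    rw [ae_restrict_iff' measurableSet_Ioo]
    exact ae_of_all _ hg
  have hmeas : AEStronglyMeasurable ({z : ℝ × ℝ | z.2 < z.1}.indicator fun z => f z.1 * g z.2)
      ((volume.restrict (Ioo (0 : ℝ) 1)).prod (volume.restrict (Ioo (0 : ℝ) 1))) :=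
    (hfm.comp_fst.mul hgm.comp_snd).indicator (measurableSet_lt measurable_snd measurable_fst)
  have hslice : ∀ x s, {z : ℝ × ℝ | z.2 < z.1}.indicator (fun z => f z.1 * g z.2) (x, s)
      = (Iio x).indicator (fun s => f x * g s) s := fun x s => by
    by_cases hs : s < x <;> simp [indicator, hs]
  rw [integrable_prod_iff hmeas]
  refine ⟨ae_of_all _ fun x => ?_, ?_⟩
  · simp only [hslice]
    exact (hgi.const_mul (f x)).indicator measurableSet_Iio
  · refine Integrable.mono' (hf.norm.const_mul C) hmeas.norm.integral_prod_right' ?_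
    rw [ae_restrict_iff' measurableSet_Ioo]
    refine ae_of_all _ fun x hx => ?_
    simp only [hslice, norm_indicator_eq_indicator_norm]
    rw [← intervalIntegral_eq_integral_indicator (fun s => ‖f x * g s‖) hx,
      intervalIntegral.integral_of_le hx.1.le]
    have hle : ∀ s ∈ Ioc 0 x, ‖‖f x * g s‖‖ ≤ |f x| * C := fun s hs => by
      rw [norm_norm, norm_mul]
      exact mul_le_mul_of_nonneg_left (hg s ⟨hs.1, hs.2.trans_lt hx.2⟩) (abs_nonneg _)
    refine (norm_setIntegral_le_of_norm_le_const (by simp) hle).trans (le_of_eq ?_)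
    simp [abs_of_pos hx.1, hx.1.le]
    ring

/-! ### Primitives and weak derivatives -/

theorem intervalIntegrable_of_integrableOn_Ioo {g : ℝ → ℝ} (hg : IntegrableOn g (Ioo 0 1))
    {x y : ℝ} (hx : x ∈ Icc (0 : ℝ) 1) (hy : y ∈ Icc (0 : ℝ) 1) :
    IntervalIntegrable g volume x y := by
  rw [← integrableOn_Icc_iff_integrableOn_Ioo] at hg
  exact (hg.mono_set (uIcc_subset_Icc hx hy)).intervalIntegrable

theorem continuousOn_primitive_of_integrableOn {g : ℝ → ℝ} (hg : IntegrableOn g (Ioo 0 1)) :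
    ContinuousOn (fun x => ∫ s in (0 : ℝ)..x, g s) (Icc 0 1) := by
  rw [← integrableOn_Icc_iff_integrableOn_Ioo] at hg
  have := intervalIntegral.continuousOn_primitive_interval (a := 0) (b := 1) (f := g) (μ := volume)
    (by rwa [uIcc_of_le zero_le_one])
  rwa [uIcc_of_le zero_le_one] at this

theorem integrableOn_of_continuousOn_Icc {f : ℝ → ℝ} (hf : ContinuousOn f (Icc 0 1)) :
    IntegrableOn f (Ioo 0 1) :=
  (hf.integrableOn_compact isCompact_Icc).mono_set Ioo_subset_Icc_self

theorem hasWeakDeriv_one_primitive {g : ℝ → ℝ} (hg : IntegrableOn g (Ioo 0 1)) :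
    HasWeakDeriv 1 (fun x => ∫ s in (0 : ℝ)..x, g s) g := by
  refine ⟨(integrableOn_of_continuousOn_Icc
    (continuousOn_primitive_of_integrableOn hg)).locallyIntegrableOn,
    hg.locallyIntegrableOn, fun φ h1 h2 h3 => ?_⟩
  have hφ : IsTest φ := ⟨h1, h2, h3⟩
  have hi : IntegrableOn (deriv φ) (Ioo 0 1) :=
    integrableOn_of_continuousOn_Icc hφ.deriv.continuous.continuousOn
  simp only [iteratedDeriv_one, mul_comm _ (deriv φ _)]
  rw [integral_mul_primitive hi hg, ← integral_const_mul]
  refine integral_congr_ae (ae_of_all _ fun s => ?_)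
  have : ∫ x in s..1, deriv φ x = - φ s := by
    rw [intervalIntegral.integral_eq_sub_of_hasDerivAt (fun s _ => hφ.hasDerivAt s)
      (hφ.deriv.continuous.intervalIntegrable _ _), hφ.map_one, zero_sub]
  simp only [this]
  ring

/-- Two functions continuous on `(0, 1]` and almost everywhere equal agree on `(0, 1]`. -/
theorem eqOn_Ioc_of_ae_eq {f g : ℝ → ℝ} (hf : ContinuousOn f (Ioc 0 1))
    (hg : ContinuousOn g (Ioc 0 1)) (h : f =ᵐ[volume.restrict (Ioo (0 : ℝ) 1)] g) :
    EqOn f g (Ioc 0 1) := by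
  have h1 : EqOn f g (Ioo 0 1) :=
    Measure.eqOn_open_of_ae_eq h isOpen_Ioo (hf.mono Ioo_subset_Ioc_self)
      (hg.mono Ioo_subset_Ioc_self)
  refine h1.of_subset_closure hf hg Ioo_subset_Ioc_self ?_
  rw [closure_Ioo zero_ne_one]
  exact Ioc_subset_Icc_self

theorem eqOn_Icc_of_ae_eq {f g : ℝ → ℝ} (hf : ContinuousOn f (Icc 0 1))
    (hg : ContinuousOn g (Icc 0 1)) (h : f =ᵐ[volume.restrict (Ioo (0 : ℝ) 1)] g) :
    EqOn f g (Icc 0 1) := by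
  have h1 : EqOn f g (Ioo 0 1) :=
    Measure.eqOn_open_of_ae_eq h isOpen_Ioo (hf.mono Ioo_subset_Icc_self)
      (hg.mono Ioo_subset_Icc_self)
  refine h1.of_subset_closure hf hg Ioo_subset_Icc_self ?_
  rw [closure_Ioo zero_ne_one]

/-- A continuous function with integrable weak derivative is the primitive of this derivative. -/
theorem HasWeakDeriv.eq_primitive {f g : ℝ → ℝ} (h : HasWeakDeriv 1 f g)
    (hf : ContinuousOn f (Icc 0 1)) (hg : IntegrableOn g (Ioo 0 1)) {x : ℝ}
    (hx : x ∈ Icc (0 : ℝ) 1) : f x = f 0 + ∫ s in (0 : ℝ)..x, g s := by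
  have hG := hasWeakDeriv_one_primitive hg
  have hGc := continuousOn_primitive_of_integrableOn hg
  have hd := h.add (hG.smul (-1))
  obtain ⟨c, hc⟩ := ae_const_of_integral_mul_deriv_eq_zero
    (h := f + (-1 : ℝ) • fun x => ∫ s in (0 : ℝ)..x, g s)
    (integrableOn_of_continuousOn_Icc (hf.add (hGc.const_smul (-1 : ℝ)))) (fun φ hφ => by
      have := hd.2.2 φ hφ.contDiff hφ.hasCompactSupport hφ.tsupport_subset
      rw [iteratedDeriv_one] at this
      simpa using this)
  have he := eqOn_Icc_of_ae_eq (hf.add (hGc.const_smul (-1 : ℝ))) continuousOn_const hc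
  have h0 := he (left_mem_Icc.2 zero_le_one)
  have h1 := he hx
  simp at h0 h1
  linarith

/-! ### The degenerate weight and the weighted space -/

/-- What the two kinds of degeneracy have in common, and all that is used of them: regularity,
positivity, and the bound `x |a'| ≤ 2 a` on `(0, 1]`. -/
structure IsDegenerateWeight (a : ℝ → ℝ) : Prop where
  continuousOn : ContinuousOn a (Icc 0 1)
  contDiffOn : ContDiffOn ℝ 1 a (Ioc 0 1)
  pos : ∀ x ∈ Ioc (0 : ℝ) 1, 0 < a x
  mul_abs_derivWithin_le : ∀ x ∈ Ioc (0 : ℝ) 1, x * |derivWithin a (Ioc 0 1) x| ≤ 2 * a x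

theorem IsDegeneracyConstant.mul_abs_derivWithin_le {a : ℝ → ℝ} {K : ℝ}
    (h : IsDegeneracyConstant a K) (hK : K ≤ 2) (hpos : ∀ x ∈ Ioc (0 : ℝ) 1, 0 < a x) :
    ∀ x ∈ Ioc (0 : ℝ) 1, x * |derivWithin a (Ioc 0 1) x| ≤ 2 * a x := by
  intro x hx
  have h1 := (h.1 (mem_image_of_mem _ hx)).trans hK
  rwa [div_le_iff₀ (hpos x hx)] at h1

theorem WeaklyDegenerate.isDegenerateWeight {a : ℝ → ℝ} (h : WeaklyDegenerate a) :
    IsDegenerateWeight a := by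
  obtain ⟨K, hK, hc⟩ := h.constant
  exact ⟨h.continuousOn, h.contDiffOn, h.pos,
    hc.mul_abs_derivWithin_le (by linarith [hK.2]) h.pos⟩

theorem StronglyDegenerate.isDegenerateWeight {a : ℝ → ℝ} (h : StronglyDegenerate a) :
    IsDegenerateWeight a := by
  obtain ⟨K, hK, hc⟩ := h.constant
  exact ⟨h.contDiffOn.continuousOn, h.contDiffOn.mono Ioc_subset_Icc_self, h.pos,
    hc.mul_abs_derivWithin_le hK.2.le h.pos⟩

namespace IsDegenerateWeight

variable {a : ℝ → ℝ}

theorem pos' (ha : IsDegenerateWeight a) {x : ℝ} (hx : x ∈ Ioo (0 : ℝ) 1) : 0 < a x :=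
  ha.pos x (Ioo_subset_Ioc_self hx)

theorem one_pos (ha : IsDegenerateWeight a) : 0 < a 1 := ha.pos 1 (right_mem_Ioc.2 zero_lt_one)

theorem hasDerivAt (ha : IsDegenerateWeight a) {x : ℝ} (hx : x ∈ Ioo (0 : ℝ) 1) :
    HasDerivAt a (deriv a x) x :=
  ((ha.contDiffOn.differentiableOn one_ne_zero).differentiableAt
    (Ioc_mem_nhds hx.1 hx.2)).hasDerivAt

theorem continuousOn_deriv (ha : IsDegenerateWeight a) : ContinuousOn (deriv a) (Ioo 0 1) :=
  (ha.contDiffOn.mono Ioo_subset_Ioc_self).continuousOn_deriv_of_isOpen isOpen_Ioo le_rfl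

theorem mul_abs_deriv_le (ha : IsDegenerateWeight a) {x : ℝ} (hx : x ∈ Ioo (0 : ℝ) 1) :
    x * |deriv a x| ≤ 2 * a x := by
  have h := ha.mul_abs_derivWithin_le x (Ioo_subset_Ioc_self hx)
  rwa [derivWithin_of_mem_nhds (Ioc_mem_nhds hx.1 hx.2)] at h

/-- The derivative of the multiplier `x² / a(x)`. -/
def multiplierDeriv (a : ℝ → ℝ) (x : ℝ) : ℝ := (2 * x * a x - x ^ 2 * deriv a x) / a x ^ 2

theorem hasDerivAt_multiplier (ha : IsDegenerateWeight a) {x : ℝ} (hx : x ∈ Ioo (0 : ℝ) 1) :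
    HasDerivAt (fun x => x ^ 2 / a x) (multiplierDeriv a x) x := by
  have h : HasDerivAt (fun x => x ^ 2 / a x) _ x :=
    (hasDerivAt_pow 2 x).div (ha.hasDerivAt hx) (ha.pos' hx).ne'
  simpa [multiplierDeriv] using h

theorem continuousOn_multiplierDeriv (ha : IsDegenerateWeight a) :
    ContinuousOn (multiplierDeriv a) (Ioo 0 1) := by
  have h1 : ContinuousOn a (Ioo 0 1) := ha.continuousOn.mono Ioo_subset_Icc_self
  have h2 := ha.continuousOn_deriv
  refine ContinuousOn.div (by fun_prop) (by fun_prop) fun x hx => (pow_pos (ha.pos' hx) 2).ne'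

theorem multiplierDeriv_nonneg (ha : IsDegenerateWeight a) {x : ℝ} (hx : x ∈ Ioo (0 : ℝ) 1) :
    0 ≤ multiplierDeriv a x := by
  have h := ha.mul_abs_deriv_le hx
  have h1 : x * deriv a x ≤ 2 * a x :=
    (mul_le_mul_of_nonneg_left (le_abs_self _) hx.1.le).trans h
  refine div_nonneg ?_ (sq_nonneg _)
  nlinarith [mul_le_mul_of_nonneg_left h1 hx.1.le]

theorem multiplierDeriv_le (ha : IsDegenerateWeight a) {x : ℝ} (hx : x ∈ Ioo (0 : ℝ) 1) :
    multiplierDeriv a x ≤ 4 / a x := by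
  have h := ha.mul_abs_deriv_le hx
  have hp := ha.pos' hx
  have h1 : x * (-deriv a x) ≤ 2 * a x :=
    (mul_le_mul_of_nonneg_left (neg_le_abs _) hx.1.le).trans h
  rw [multiplierDeriv, div_le_div_iff₀ (by positivity) hp]
  have h2 : 2 * x * a x - x ^ 2 * deriv a x ≤ 4 * a x := by
    nlinarith [mul_le_mul_of_nonneg_left h1 hx.1.le, mul_pos hp (sub_pos.2 hx.2)]
  nlinarith [mul_le_mul_of_nonneg_right h2 hp.le]

/-- The multiplier `x² / a` is nondecreasing, because `x a' ≤ 2 a`. -/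
theorem multiplier_le (ha : IsDegenerateWeight a) {x : ℝ} (hx : x ∈ Ioc (0 : ℝ) 1) :
    x ^ 2 / a x ≤ 1 / a 1 := by
  have hmono : MonotoneOn (fun x => x ^ 2 / a x) (Ioc 0 1) := by
    refine monotoneOn_of_deriv_nonneg (convex_Ioc 0 1) ?_ ?_ ?_
    · exact ContinuousOn.div (by fun_prop) (ha.continuousOn.mono Ioc_subset_Icc_self)
        fun x hx => (ha.pos x hx).ne'
    · rw [interior_Ioc]
      exact fun x hx => (ha.hasDerivAt_multiplier hx).differentiableAt.differentiableWithinAt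
    · rw [interior_Ioc]
      intro x hx
      rw [(ha.hasDerivAt_multiplier hx).deriv]
      exact ha.multiplierDeriv_nonneg hx
  simpa using hmono hx (right_mem_Ioc.2 zero_lt_one) hx.2

theorem aemeasurable (ha : IsDegenerateWeight a) :
    AEMeasurable a (volume.restrict (Ioo (0 : ℝ) 1)) :=
  (ha.continuousOn.mono Ioo_subset_Icc_self).aemeasurable measurableSet_Ioo

theorem aemeasurable_density (ha : IsDegenerateWeight a) :
    AEMeasurable (fun x => ENNReal.ofReal (1 / a x)) (volume.restrict (Ioo (0 : ℝ) 1)) :=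
  (ha.aemeasurable.const_div 1).ennreal_ofReal

theorem ae_weightedMeasure (ha : IsDegenerateWeight a) :
    ae (weightedMeasure a) = ae (volume.restrict (Ioo (0 : ℝ) 1)) := by
  refine le_antisymm (withDensity_absolutelyContinuous _ _).ae_le ?_
  refine (withDensity_absolutelyContinuous' ha.aemeasurable_density ?_).ae_le
  rw [ae_restrict_iff' measurableSet_Ioo]
  refine ae_of_all _ fun x hx => ?_
  rw [ne_eq, ENNReal.ofReal_eq_zero, not_le]
  exact one_div_pos.2 (ha.pos' hx)

theorem aestronglyMeasurable_weightedMeasure (ha : IsDegenerateWeight a) {f : ℝ → ℝ} :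
    AEStronglyMeasurable f (weightedMeasure a) ↔
      AEStronglyMeasurable f (volume.restrict (Ioo (0 : ℝ) 1)) := by
  constructor <;> rintro ⟨g, hg, h⟩ <;> refine ⟨g, hg, ?_⟩
  · rwa [EventuallyEq, ha.ae_weightedMeasure] at h
  · rwa [EventuallyEq, ha.ae_weightedMeasure]

theorem integral_weightedMeasure (ha : IsDegenerateWeight a) (f : ℝ → ℝ) :
    ∫ x, f x ∂weightedMeasure a = ∫ x in Ioo (0 : ℝ) 1, f x / a x := by
  rw [weightedMeasure, integral_withDensity_eq_integral_toReal_smul₀ ha.aemeasurable_density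
    (ae_of_all _ fun x => ENNReal.ofReal_lt_top)]
  refine setIntegral_congr_fun measurableSet_Ioo fun x hx => ?_
  have := ha.pos' hx
  simp only [smul_eq_mul]
  rw [ENNReal.toReal_ofReal (by positivity)]
  ring

theorem integrable_weightedMeasure (ha : IsDegenerateWeight a) {f : ℝ → ℝ} :
    Integrable f (weightedMeasure a) ↔ IntegrableOn (fun x => f x / a x) (Ioo 0 1) := by
  rw [weightedMeasure, integrable_withDensity_iff_integrable_smul₀' ha.aemeasurable_density
    (ae_of_all _ fun x => ENNReal.ofReal_lt_top), IntegrableOn]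
  refine integrable_congr ?_
  rw [EventuallyEq, ae_restrict_iff' measurableSet_Ioo]
  refine ae_of_all _ fun x hx => ?_
  have := ha.pos' hx
  rw [smul_eq_mul, ENNReal.toReal_ofReal (by positivity)]
  ring

theorem inner_L2w (ha : IsDegenerateWeight a) (u v : L2w a) :
    inner ℝ u v = ∫ x in Ioo (0 : ℝ) 1, u x * v x / a x := by
  rw [L2.inner_def, ← ha.integral_weightedMeasure]
  refine integral_congr_ae (ae_of_all _ fun x => ?_)
  simp [mul_comm]

theorem integrable_L2w_mul (ha : IsDegenerateWeight a) (u v : L2w a) :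
    IntegrableOn (fun x => u x * v x / a x) (Ioo 0 1) := by
  rw [← ha.integrable_weightedMeasure]
  refine (L2.integrable_inner (𝕜 := ℝ) u v).congr (ae_of_all _ fun x => ?_)
  simp [mul_comm]

theorem norm_sq_L2w (ha : IsDegenerateWeight a) (v : L2w a) :
    ‖v‖ ^ 2 = ∫ x in Ioo (0 : ℝ) 1, v x ^ 2 / a x := by
  rw [← real_inner_self_eq_norm_sq, ha.inner_L2w]
  simp only [sq]

theorem memLp_weightedMeasure (ha : IsDegenerateWeight a) {f : ℝ → ℝ}
    (hf : AEStronglyMeasurable f (volume.restrict (Ioo (0 : ℝ) 1))) :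
    MemLp f 2 (weightedMeasure a) ↔ IntegrableOn (fun x => f x ^ 2 / a x) (Ioo 0 1) := by
  rw [memLp_two_iff_integrable_sq (ha.aestronglyMeasurable_weightedMeasure.2 hf),
    ha.integrable_weightedMeasure]

end IsDegenerateWeight

theorem inner_L2 (f g : L2) : inner ℝ f g = ∫ x in Ioo (0 : ℝ) 1, f x * g x := by
  rw [L2.inner_def]
  refine integral_congr_ae (ae_of_all _ fun x => ?_)
  simp [mul_comm]

theorem integrable_L2_mul (f g : L2) : IntegrableOn (fun x => f x * g x) (Ioo 0 1) := by
  refine (L2.integrable_inner (𝕜 := ℝ) f g).congr (ae_of_all _ fun x => ?_)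
  simp [mul_comm]

theorem norm_sq_L2 (f : L2) : ‖f‖ ^ 2 = ∫ x in Ioo (0 : ℝ) 1, f x ^ 2 := by
  rw [← real_inner_self_eq_norm_sq, inner_L2]
  simp only [sq]

theorem integrable_L2_sq (f : L2) : IntegrableOn (fun x => f x ^ 2) (Ioo 0 1) := by
  simpa only [sq] using integrable_L2_mul f f

theorem integrable_L2 (f : L2) : IntegrableOn f (Ioo 0 1) := by
  exact (Lp.memLp f).integrable one_le_two

namespace IsDegenerateWeight

variable {a : ℝ → ℝ}

theorem integrableOn_sq_mul (ha : IsDegenerateWeight a) (z : L2) :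
    IntegrableOn (fun x => (x ^ 2 * z x) ^ 2 / a x) (Ioo 0 1) := by
  refine ((integrable_L2_sq z).const_mul (1 / a 1)).mono' ?_ ?_
  · have := (Lp.aestronglyMeasurable z).aemeasurable
    have h2 := ha.aemeasurable
    exact AEMeasurable.aestronglyMeasurable (by fun_prop)
  · rw [ae_restrict_iff' measurableSet_Ioo]
    refine ae_of_all _ fun x hx => ?_
    have hp := ha.pos' hx
    rw [Real.norm_of_nonneg (by positivity)]
    have h1 := ha.multiplier_le (Ioo_subset_Ioc_self hx)
    have h2 : x ^ 2 * (x ^ 2 / a x) ≤ 1 * (1 / a 1) :=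
      mul_le_mul (by nlinarith [hx.1, hx.2]) h1 (by positivity) zero_le_one
    calc (x ^ 2 * z x) ^ 2 / a x = x ^ 2 * (x ^ 2 / a x) * z x ^ 2 := by ring
      _ ≤ _ := by
        rw [one_mul] at h2
        exact mul_le_mul_of_nonneg_right h2 (sq_nonneg _)

theorem memLp_sq_mul (ha : IsDegenerateWeight a) (z : L2) :
    MemLp (fun x => x ^ 2 * z x) 2 (weightedMeasure a) := by
  refine (ha.memLp_weightedMeasure ?_).2 (ha.integrableOn_sq_mul z)
  exact ((by fun_prop : Continuous fun x : ℝ => x ^ 2).aestronglyMeasurable).mul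
    (Lp.aestronglyMeasurable z)

theorem coeFn_toLp_sq_mul (ha : IsDegenerateWeight a) (z : L2) :
    ((ha.memLp_sq_mul z).toLp _ : L2w a) =ᵐ[volume.restrict (Ioo (0 : ℝ) 1)]
      fun x => x ^ 2 * z x := by
  have := (ha.memLp_sq_mul z).coeFn_toLp
  rwa [EventuallyEq, ha.ae_weightedMeasure] at this

theorem norm_sq_toLp_sq_mul_le (ha : IsDegenerateWeight a) (z : L2) :
    ‖((ha.memLp_sq_mul z).toLp _ : L2w a)‖ ^ 2 ≤ 1 / a 1 * ‖z‖ ^ 2 := by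
  rw [ha.norm_sq_L2w, norm_sq_L2, ← integral_const_mul]
  have h1 : ∫ x in Ioo (0 : ℝ) 1, ((ha.memLp_sq_mul z).toLp _ : L2w a) x ^ 2 / a x
      = ∫ x in Ioo (0 : ℝ) 1, (x ^ 2 * z x) ^ 2 / a x :=
    integral_congr_ae ((ha.coeFn_toLp_sq_mul z).mono fun x hx => by simp only [hx])
  rw [h1]
  refine setIntegral_mono_on (ha.integrableOn_sq_mul z) ((integrable_L2_sq z).const_mul _)
    measurableSet_Ioo fun x hx => ?_
  have hp := ha.pos' hx
  have h1 := ha.multiplier_le (Ioo_subset_Ioc_self hx)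
  have h2 : x ^ 2 * (x ^ 2 / a x) ≤ 1 * (1 / a 1) :=
    mul_le_mul (by nlinarith [hx.1, hx.2]) h1 (by positivity) zero_le_one
  calc (x ^ 2 * z x) ^ 2 / a x = x ^ 2 * (x ^ 2 / a x) * z x ^ 2 := by ring
    _ ≤ _ := by
      rw [one_mul] at h2
      exact mul_le_mul_of_nonneg_right h2 (sq_nonneg _)

/-- Multiplication by `x²`, as a bounded operator from `L²` to `L²_{1/a}`. -/
def mulSq (ha : IsDegenerateWeight a) : L2 →L[ℝ] L2w a :=
  LinearMap.mkContinuous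
    { toFun := fun z => (ha.memLp_sq_mul z).toLp _
      map_add' := fun z z' => by
        rw [← MemLp.toLp_add]
        refine MemLp.toLp_congr _ _ ?_
        rw [EventuallyEq, ha.ae_weightedMeasure]
        filter_upwards [Lp.coeFn_add z z'] with x hx
        simp only [hx, Pi.add_apply, mul_add]
      map_smul' := fun c z => by
        rw [RingHom.id_apply, ← MemLp.toLp_const_smul]
        refine MemLp.toLp_congr _ _ ?_
        rw [EventuallyEq, ha.ae_weightedMeasure]
        filter_upwards [Lp.coeFn_smul c z] with x hx
        simp only [hx, Pi.smul_apply, smul_eq_mul]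
        ring }
    (√(1 / a 1)) fun z => by
      refine le_of_sq_le_sq ?_ (by positivity)
      rw [mul_pow, Real.sq_sqrt (one_div_pos.2 ha.one_pos).le]
      exact ha.norm_sq_toLp_sq_mul_le z

theorem coeFn_mulSq (ha : IsDegenerateWeight a) (z : L2) :
    ha.mulSq z =ᵐ[volume.restrict (Ioo (0 : ℝ) 1)] fun x => x ^ 2 * z x :=
  ha.coeFn_toLp_sq_mul z

theorem norm_sq_mulSq_le (ha : IsDegenerateWeight a) (z : L2) :
    ‖ha.mulSq z‖ ^ 2 ≤ 1 / a 1 * ‖z‖ ^ 2 :=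
  ha.norm_sq_toLp_sq_mul_le z

theorem inner_mulSq (ha : IsDegenerateWeight a) (v : L2w a) (z : L2) :
    inner ℝ v (ha.mulSq z) = ∫ x in Ioo (0 : ℝ) 1, v x / a x * (x ^ 2 * z x) := by
  rw [ha.inner_L2w]
  refine integral_congr_ae ((ha.coeFn_mulSq z).mono fun x hx => ?_)
  simp only [hx]
  ring

end IsDegenerateWeight

/-! ### The space `H²_{1/a}(0, 1)` -/

theorem abs_primitive_le (f : L2) {x : ℝ} (hx : x ∈ Icc (0 : ℝ) 1) :
    |∫ s in (0 : ℝ)..x, f s| ≤ ‖f‖ := by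
  have hμ : volume.restrict (Ioo (0 : ℝ) 1) (Ioo 0 x) ≠ ⊤ := measure_ne_top _ _
  have h1 : inner ℝ (indicatorConstLp 2 measurableSet_Ioo hμ (1 : ℝ)) f
      = ∫ s in (0 : ℝ)..x, f s := by
    rw [L2.inner_indicatorConstLp_one, Measure.restrict_restrict measurableSet_Ioo,
      intervalIntegral.integral_of_le hx.1, integral_Ioc_eq_integral_Ioo,
      inter_eq_self_of_subset_left (Ioo_subset_Ioo_right hx.2)]
  rw [← h1]
  refine (abs_real_inner_le_norm _ _).trans (mul_le_of_le_one_left (norm_nonneg _) ?_)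
  rw [norm_indicatorConstLp two_ne_zero ENNReal.ofNat_ne_top, norm_one, one_mul]
  refine Real.rpow_le_one measureReal_nonneg ?_ (by norm_num)
  rw [measureReal_restrict_apply measurableSet_Ioo,
    inter_eq_self_of_subset_left (Ioo_subset_Ioo_right hx.2)]
  simp [hx.1, hx.2]

theorem primitive_sub (f g : L2) {x : ℝ} (hx : x ∈ Icc (0 : ℝ) 1) :
    ∫ s in (0 : ℝ)..x, (f - g : L2) s
      = (∫ s in (0 : ℝ)..x, f s) - ∫ s in (0 : ℝ)..x, g s := by
  have h0 : (0 : ℝ) ∈ Icc (0 : ℝ) 1 := left_mem_Icc.2 zero_le_one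
  rw [← intervalIntegral.integral_sub
    (intervalIntegrable_of_integrableOn_Ioo (integrable_L2 f) h0 hx)
    (intervalIntegrable_of_integrableOn_Ioo (integrable_L2 g) h0 hx),
    intervalIntegral.integral_of_le hx.1, intervalIntegral.integral_of_le hx.1,
    integral_Ioc_eq_integral_Ioo, integral_Ioc_eq_integral_Ioo]
  refine integral_congr_ae (ae_restrict_of_ae_restrict_of_subset (Ioo_subset_Ioo_right hx.2) ?_)
  exact (Lp.coeFn_sub f g).mono fun s hs => by rw [hs, Pi.sub_apply]

theorem continuousOn_primitive (f : L2) :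
    ContinuousOn (fun x => ∫ s in (0 : ℝ)..x, f s) (Icc 0 1) :=
  continuousOn_primitive_of_integrableOn (integrable_L2 f)

theorem continuousOn_primitive_primitive (f : L2) :
    ContinuousOn (fun x => ∫ s in (0 : ℝ)..x, ∫ r in (0 : ℝ)..s, f r) (Icc 0 1) :=
  continuousOn_primitive_of_integrableOn
    (integrableOn_of_continuousOn_Icc (continuousOn_primitive f))

theorem abs_primitive_primitive_sub_le (f g : L2) {x : ℝ} (hx : x ∈ Icc (0 : ℝ) 1) :
    |(∫ s in (0 : ℝ)..x, ∫ r in (0 : ℝ)..s, f r) - ∫ s in (0 : ℝ)..x, ∫ r in (0 : ℝ)..s, g r|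
      ≤ ‖f - g‖ := by
  have h0 : (0 : ℝ) ∈ Icc (0 : ℝ) 1 := left_mem_Icc.2 zero_le_one
  rw [← intervalIntegral.integral_sub
    (intervalIntegrable_of_integrableOn_Ioo
      (integrableOn_of_continuousOn_Icc (continuousOn_primitive f)) h0 hx)
    (intervalIntegrable_of_integrableOn_Ioo
      (integrableOn_of_continuousOn_Icc (continuousOn_primitive g)) h0 hx)]
  have h1 := intervalIntegral.norm_integral_le_of_norm_le_const (a := 0) (b := x) (C := ‖f - g‖)
    (f := fun s => (∫ r in (0 : ℝ)..s, f r) - ∫ r in (0 : ℝ)..s, g r) (fun s hs => by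
      rw [uIoc_of_le hx.1] at hs
      have hs' : s ∈ Icc (0 : ℝ) 1 := ⟨hs.1.le, hs.2.trans hx.2⟩
      rw [← primitive_sub f g hs']
      exact abs_primitive_le _ hs')
  rw [Real.norm_eq_abs, sub_zero, abs_of_nonneg hx.1] at h1
  exact h1.trans (mul_le_of_le_one_right (norm_nonneg _) hx.2)

theorem tendsto_primitive {f : ℕ → L2} {g : L2} (h : Tendsto f atTop (𝓝 g)) {x : ℝ}
    (hx : x ∈ Icc (0 : ℝ) 1) :
    Tendsto (fun n => ∫ s in (0 : ℝ)..x, f n s) atTop (𝓝 (∫ s in (0 : ℝ)..x, g s)) := by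
  rw [tendsto_iff_norm_sub_tendsto_zero] at h ⊢
  refine squeeze_zero (fun _ => norm_nonneg _) (fun n => ?_) h
  rw [← primitive_sub _ _ hx]
  exact abs_primitive_le _ hx

theorem tendsto_primitive_primitive {f : ℕ → L2} {g : L2} (h : Tendsto f atTop (𝓝 g)) {x : ℝ}
    (hx : x ∈ Icc (0 : ℝ) 1) :
    Tendsto (fun n => ∫ s in (0 : ℝ)..x, ∫ r in (0 : ℝ)..s, f n r) atTop
      (𝓝 (∫ s in (0 : ℝ)..x, ∫ r in (0 : ℝ)..s, g r)) := by
  rw [tendsto_iff_norm_sub_tendsto_zero] at h ⊢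
  exact squeeze_zero (fun _ => norm_nonneg _)
    (fun n => abs_primitive_primitive_sub_le _ _ hx) h

theorem HasWeakDeriv.congr_left {n : ℕ} {f g h : ℝ → ℝ} (hf : HasWeakDeriv n f g)
    (hfh : f =ᵐ[volume.restrict (Ioo (0 : ℝ) 1)] h) : HasWeakDeriv n h g := by
  obtain ⟨h1, h2, h3⟩ := hf
  refine ⟨?_, h2, fun φ hφ hc hs => ?_⟩
  · rw [locallyIntegrableOn_iff isOpen_Ioo.isLocallyClosed] at h1 ⊢
    exact fun k hk hkc => (h1 k hk hkc).congr_fun_ae (ae_restrict_of_ae_restrict_of_subset hk hfh)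
  · rw [← h3 φ hφ hc hs]
    exact integral_congr_ae (hfh.mono fun x hx => by simp only [hx])

/-- An element of `H²_{1/a}(0, 1)` is the twofold primitive of its second derivative, which is
orthogonal to the affine functions. -/
theorem IsDegenerateWeight.isH2Triple_iff {a : ℝ → ℝ} (ha : IsDegenerateWeight a) (u : L2w a)
    (u' u'' : L2) :
    IsH2Triple a u u' u'' ↔ (∫ x in (0 : ℝ)..1, u'' x) = 0 ∧
      (∫ x in (0 : ℝ)..1, ∫ s in (0 : ℝ)..x, u'' s) = 0 ∧
      (u' =ᵐ[volume.restrict (Ioo (0 : ℝ) 1)] fun x => ∫ s in (0 : ℝ)..x, u'' s) ∧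
      (u =ᵐ[volume.restrict (Ioo (0 : ℝ) 1)] fun x =>
        ∫ s in (0 : ℝ)..x, ∫ r in (0 : ℝ)..s, u'' r) := by
  have hone : (1 : ℝ) ∈ Icc (0 : ℝ) 1 := right_mem_Icc.2 zero_le_one
  constructor
  · rintro ⟨w, w', h1, h2, h3, h4, h5, h6, h7, h8, h9, h10⟩
    rw [EventuallyEq, ha.ae_weightedMeasure] at h7
    have e1 : ∀ x ∈ Icc (0 : ℝ) 1, w' x = ∫ s in (0 : ℝ)..x, u'' s := fun x hx => by
      rw [h10.eq_primitive h2 (integrable_L2 u'') hx, h5, zero_add]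
    have e2 : ∀ x ∈ Icc (0 : ℝ) 1, w x = ∫ s in (0 : ℝ)..x, ∫ r in (0 : ℝ)..s, u'' r :=
      fun x hx => by
        rw [h9.eq_primitive h1 (integrableOn_of_continuousOn_Icc h2) hx, h3, zero_add]
        refine intervalIntegral.integral_congr fun s hs => e1 s ?_
        rw [uIcc_of_le hx.1] at hs
        exact ⟨hs.1, hs.2.trans hx.2⟩
    refine ⟨by rw [← e1 1 hone, h6], by rw [← e2 1 hone, h4], ?_, ?_⟩
    · filter_upwards [h8, ae_restrict_mem measurableSet_Ioo] with x hx hx'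
      rw [hx, e1 x (Ioo_subset_Icc_self hx')]
    · filter_upwards [h7, ae_restrict_mem measurableSet_Ioo] with x hx hx'
      rw [hx, e2 x (Ioo_subset_Icc_self hx')]
  · rintro ⟨h1, h2, h3, h4⟩
    refine ⟨_, _, continuousOn_primitive_primitive u'', continuousOn_primitive u'', by simp, h2,
      by simp, h1, ?_, h3, ?_, hasWeakDeriv_one_primitive (integrable_L2 u'')⟩
    · rwa [EventuallyEq, ha.ae_weightedMeasure]
    · exact hasWeakDeriv_one_primitive
        (integrableOn_of_continuousOn_Icc (continuousOn_primitive u''))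

/-- The inclusion of `H²_{1/a}(0, 1)` in `L²_{1/a}(0, 1)` as a bounded operator. -/
def toL2wL (a : ℝ → ℝ) : H2w a →L[ℝ] L2w a :=
  (WithLp.fstL 2 ℝ (L2w a) (WithLp 2 (L2 × L2))).comp (H2w a).subtypeL

/-- The first derivative as a bounded operator from `H²_{1/a}(0, 1)` to `L²(0, 1)`. -/
def d1L (a : ℝ → ℝ) : H2w a →L[ℝ] L2 :=
  (WithLp.fstL 2 ℝ L2 L2).comp
    ((WithLp.sndL 2 ℝ (L2w a) (WithLp 2 (L2 × L2))).comp (H2w a).subtypeL)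

/-- The second derivative as a bounded operator from `H²_{1/a}(0, 1)` to `L²(0, 1)`. -/
def d2L (a : ℝ → ℝ) : H2w a →L[ℝ] L2 :=
  (WithLp.sndL 2 ℝ L2 L2).comp
    ((WithLp.sndL 2 ℝ (L2w a) (WithLp 2 (L2 × L2))).comp (H2w a).subtypeL)

theorem toL2wL_apply {a : ℝ → ℝ} (u : H2w a) : toL2wL a u = toL2w u := rfl

theorem d2L_apply {a : ℝ → ℝ} (u : H2w a) : d2L a u = d2 u := rfl

/-- The continuous representative of `u'`, for `u ∈ H²_{1/a}(0, 1)`. -/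
def derivRep {a : ℝ → ℝ} (u : H2w a) (x : ℝ) : ℝ := ∫ s in (0 : ℝ)..x, d2 u s

/-- The continuous representative of `u ∈ H²_{1/a}(0, 1)`. -/
def rep {a : ℝ → ℝ} (u : H2w a) (x : ℝ) : ℝ := ∫ s in (0 : ℝ)..x, derivRep u s

section H2

variable {a : ℝ → ℝ}

theorem continuousOn_derivRep (u : H2w a) : ContinuousOn (derivRep u) (Icc 0 1) :=
  continuousOn_primitive _

theorem continuousOn_rep (u : H2w a) : ContinuousOn (rep u) (Icc 0 1) :=
  continuousOn_primitive_primitive _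

theorem derivRep_zero (u : H2w a) : derivRep u 0 = 0 := by simp [derivRep]

theorem rep_zero (u : H2w a) : rep u 0 = 0 := by simp [rep]

theorem IsDegenerateWeight.derivRep_one (ha : IsDegenerateWeight a) (u : H2w a) :
    derivRep u 1 = 0 := ((ha.isH2Triple_iff _ _ _).1 u.2).1

theorem IsDegenerateWeight.rep_one (ha : IsDegenerateWeight a) (u : H2w a) :
    rep u 1 = 0 := ((ha.isH2Triple_iff _ _ _).1 u.2).2.1

theorem IsDegenerateWeight.d1_ae_eq (ha : IsDegenerateWeight a) (u : H2w a) :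
    d1L a u =ᵐ[volume.restrict (Ioo (0 : ℝ) 1)] derivRep u :=
  ((ha.isH2Triple_iff _ _ _).1 u.2).2.2.1

theorem IsDegenerateWeight.toL2w_ae_eq (ha : IsDegenerateWeight a) (u : H2w a) :
    toL2w u =ᵐ[volume.restrict (Ioo (0 : ℝ) 1)] rep u :=
  ((ha.isH2Triple_iff _ _ _).1 u.2).2.2.2

theorem abs_derivRep_le (u : H2w a) {x : ℝ} (hx : x ∈ Icc (0 : ℝ) 1) :
    |derivRep u x| ≤ ‖d2 u‖ := abs_primitive_le _ hx

theorem IsDegenerateWeight.norm_d1_le (ha : IsDegenerateWeight a) (u : H2w a) :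
    ‖d1L a u‖ ≤ ‖d2 u‖ := by
  refine le_of_sq_le_sq ?_ (norm_nonneg _)
  rw [norm_sq_L2]
  have h1 : ∫ x in Ioo (0 : ℝ) 1, (d1L a u) x ^ 2 ≤ ∫ x in Ioo (0 : ℝ) 1, ‖d2 u‖ ^ 2 := by
    refine setIntegral_mono_on_ae (integrable_L2_sq _) (integrable_const _) measurableSet_Ioo ?_
    rw [← ae_restrict_iff' measurableSet_Ioo]
    filter_upwards [ha.d1_ae_eq u, ae_restrict_mem measurableSet_Ioo] with x hx hx'
    rw [hx, ← sq_abs]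
    exact pow_le_pow_left₀ (abs_nonneg _) (abs_derivRep_le u (Ioo_subset_Icc_self hx')) 2
  simpa using h1

/-- Convergence of `u''` in `L²` makes the primitives converge pointwise, so that the integral
representation of `u` and `u'` passes to the limit along an almost everywhere convergent
subsequence. -/
theorem IsDegenerateWeight.isClosed_H2w (ha : IsDegenerateWeight a) :
    IsClosed (H2w a : Set (WithLp 2 (L2w a × WithLp 2 (L2 × L2)))) := by
  refine IsSeqClosed.isClosed fun p q hp hpq => ?_
  have hone : (1 : ℝ) ∈ Icc (0 : ℝ) 1 := right_mem_Icc.2 zero_le_one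
  have t0 : Tendsto (fun n => (p n).fst) atTop (𝓝 q.fst) :=
    ((WithLp.fstL 2 ℝ (L2w a) (WithLp 2 (L2 × L2))).continuous.tendsto q).comp hpq
  have ts : Tendsto (fun n => (p n).snd) atTop (𝓝 q.snd) :=
    ((WithLp.sndL 2 ℝ (L2w a) (WithLp 2 (L2 × L2))).continuous.tendsto q).comp hpq
  have t1 : Tendsto (fun n => (p n).snd.fst) atTop (𝓝 q.snd.fst) :=
    ((WithLp.fstL 2 ℝ L2 L2).continuous.tendsto q.snd).comp ts
  have t2 : Tendsto (fun n => (p n).snd.snd) atTop (𝓝 q.snd.snd) :=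
    ((WithLp.sndL 2 ℝ L2 L2).continuous.tendsto q.snd).comp ts
  have hp' := fun n => (ha.isH2Triple_iff _ _ _).1 (hp n)
  refine (ha.isH2Triple_iff _ _ _).2 ⟨?_, ?_, ?_, ?_⟩
  · refine tendsto_nhds_unique (tendsto_primitive t2 hone) ?_
    simp only [(hp' _).1]
    exact tendsto_const_nhds
  · refine tendsto_nhds_unique (tendsto_primitive_primitive t2 hone) ?_
    simp only [(hp' _).2.1]
    exact tendsto_const_nhds
  · obtain ⟨ns, hns, hns'⟩ := (tendstoInMeasure_of_tendsto_Lp t1).exists_seq_tendsto_ae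
    filter_upwards [hns', ae_all_iff.2 fun n => (hp' n).2.2.1,
      ae_restrict_mem measurableSet_Ioo] with x hx hx' hxI
    refine tendsto_nhds_unique hx ?_
    simp only [hx']
    exact (tendsto_primitive t2 (Ioo_subset_Icc_self hxI)).comp hns.tendsto_atTop
  · obtain ⟨ns, hns, hns'⟩ := (tendstoInMeasure_of_tendsto_Lp t0).exists_seq_tendsto_ae
    rw [ha.ae_weightedMeasure] at hns'
    filter_upwards [hns', ae_all_iff.2 fun n => (hp' n).2.2.2,
      ae_restrict_mem measurableSet_Ioo] with x hx hx' hxI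
    refine tendsto_nhds_unique hx ?_
    simp only [hx']
    exact (tendsto_primitive_primitive t2 (Ioo_subset_Icc_self hxI)).comp hns.tendsto_atTop

theorem IsDegenerateWeight.completeSpace_H2w (ha : IsDegenerateWeight a) :
    CompleteSpace (H2w a) :=
  ha.isClosed_H2w.completeSpace_coe

theorem IsDegenerateWeight.normSqH0_eq (ha : IsDegenerateWeight a) (u : H2w a) (v : L2w a) :
    normSqH0 u v = ‖d2 u‖ ^ 2 + ‖v‖ ^ 2 := by
  rw [normSqH0, norm_sq_L2, ha.norm_sq_L2w]

theorem IsDegenerateWeight.energy_eq (ha : IsDegenerateWeight a) (u : H2w a) (v : L2w a) :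
    energy u v = 1 / 2 * (‖d2 u‖ ^ 2 + ‖v‖ ^ 2) := by
  have h1 : IntegrableOn (fun x => v x ^ 2 / a x) (Ioo 0 1) := by
    simpa only [sq] using ha.integrable_L2w_mul v v
  rw [energy, integral_add h1 (integrable_L2_sq _), norm_sq_L2, ha.norm_sq_L2w, add_comm]

theorem IsA.sub {u₁ u₂ : H2w a} {f₁ f₂ : L2w a} (ha : IsDegenerateWeight a) (h₁ : IsA a u₁ f₁)
    (h₂ : IsA a u₂ f₂) : IsA a (u₁ - u₂) (f₁ - f₂) := by
  obtain ⟨w₁, k₁, l₁⟩ := h₁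
  obtain ⟨w₂, k₂, l₂⟩ := h₂
  refine ⟨w₁ + (-1 : ℝ) • w₂, (k₁.add (k₂.smul (-1))).congr_left ?_, ?_⟩
  · have : toL2w (u₁ - u₂) = toL2w u₁ - toL2w u₂ := map_sub (toL2wL a) u₁ u₂
    rw [this]
    have h := Lp.coeFn_sub (toL2w u₁) (toL2w u₂)
    rw [EventuallyEq, ha.ae_weightedMeasure] at h
    filter_upwards [h] with x hx
    rw [hx]
    simp [sub_eq_add_neg]
  · filter_upwards [Lp.coeFn_sub f₁ f₂, l₁, l₂] with x hx h1 h2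
    rw [hx, Pi.sub_apply, h1, h2]
    simp
    ring

theorem IsA.smul {u : H2w a} {f : L2w a} (ha : IsDegenerateWeight a) (c : ℝ) (h : IsA a u f) :
    IsA a (c • u) (c • f) := by
  obtain ⟨w, k, l⟩ := h
  refine ⟨c • w, (k.smul c).congr_left ?_, ?_⟩
  · have : toL2w (c • u) = c • toL2w u := map_smul (toL2wL a) c u
    rw [this]
    have h := Lp.coeFn_smul c (toL2w u)
    rw [EventuallyEq, ha.ae_weightedMeasure] at h
    exact EventuallyEq.symm h
  · filter_upwards [Lp.coeFn_smul c f, l] with x hx h1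
    rw [hx, Pi.smul_apply, h1]
    simp
    ring

end H2

/-! ### The domain of the operator: Green's formula, trace, multiplier identities -/

section Domain

variable {a : ℝ → ℝ} {u : H2w a} {f : L2w a}

theorem IsA.hasWeakDeriv (ha : IsDegenerateWeight a) (hA : IsA a u f) :
    HasWeakDeriv 4 (toL2w u) fun x => f x / a x := by
  obtain ⟨w, h1, h2⟩ := hA
  rw [EventuallyEq, ha.ae_weightedMeasure] at h2
  refine h1.congr_right ?_
  filter_upwards [h2, ae_restrict_mem measurableSet_Ioo] with x hx hx'
  rw [hx, mul_div_cancel_left₀ _ (ha.pos' hx').ne']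

theorem IsDegenerateWeight.aestronglyMeasurable_L2w (ha : IsDegenerateWeight a) (f : L2w a) :
    AEStronglyMeasurable f (volume.restrict (Ioo (0 : ℝ) 1)) :=
  ha.aestronglyMeasurable_weightedMeasure.1 (Lp.aestronglyMeasurable f)

theorem IsDegenerateWeight.aestronglyMeasurable_div (ha : IsDegenerateWeight a) (f : L2w a) :
    AEStronglyMeasurable (fun x => f x / a x) (volume.restrict (Ioo (0 : ℝ) 1)) :=
  ((ha.aestronglyMeasurable_L2w f).aemeasurable.div ha.aemeasurable).aestronglyMeasurable

/-- For `f ∈ L²_{1/a}` the function `f / a` need not be integrable at `0`, but `x f / a` is even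
square integrable, since `x² / a` is bounded. -/
theorem IsDegenerateWeight.integrableOn_mul_div (ha : IsDegenerateWeight a) (f : L2w a) :
    IntegrableOn (fun x => x * (f x / a x)) (Ioo 0 1) := by
  have hm : AEStronglyMeasurable (fun x => x * (f x / a x)) (volume.restrict (Ioo (0 : ℝ) 1)) :=
    continuous_id.aestronglyMeasurable.mul (ha.aestronglyMeasurable_div f)
  refine MemLp.integrable (q := 2) one_le_two ((memLp_two_iff_integrable_sq hm).2 ?_)
  have h1 : IntegrableOn (fun x => f x ^ 2 / a x) (Ioo 0 1) := by
    simpa only [sq] using ha.integrable_L2w_mul f f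
  refine (h1.const_mul (1 / a 1)).mono' (hm.pow 2) ?_
  rw [ae_restrict_iff' measurableSet_Ioo]
  refine ae_of_all _ fun x hx => ?_
  have hp := ha.pos' hx
  rw [Real.norm_of_nonneg (by positivity)]
  calc (x * (f x / a x)) ^ 2 = x ^ 2 / a x * (f x ^ 2 / a x) := by ring
    _ ≤ _ := mul_le_mul_of_nonneg_right (ha.multiplier_le (Ioo_subset_Ioc_self hx))
      (by positivity)

/-- The tail integral `∫ₓ¹ W` is integrable as soon as `x W(x)` is. -/
theorem integrableOn_tail {W : ℝ → ℝ}
    (hWm : AEStronglyMeasurable W (volume.restrict (Ioo (0 : ℝ) 1)))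
    (hW : IntegrableOn (fun x => x * W x) (Ioo 0 1)) :
    IntegrableOn (fun s => ∫ x in s..1, W x) (Ioo 0 1) := by
  have h1 := (integrable_triangle_of_bounded (g := fun _ => 1) (C := 1) hWm hW
    aestronglyMeasurable_const (fun x _ => by simp)).integral_prod_right
  refine h1.congr ?_
  rw [EventuallyEq, ae_restrict_iff' measurableSet_Ioo]
  refine ae_of_all _ fun x hx => ?_
  rw [intervalIntegral_eq_integral_indicator' W hx]
  congr 1; ext s
  by_cases hs : x < s <;> simp [indicator, hs]

theorem continuousAt_tail {W : ℝ → ℝ}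
    (hWm : AEStronglyMeasurable W (volume.restrict (Ioo (0 : ℝ) 1)))
    (hW : IntegrableOn (fun x => x * W x) (Ioo 0 1)) {x : ℝ} (hx : x ∈ Ioo (0 : ℝ) 1) :
    ContinuousAt (fun s => ∫ x in s..1, W x) x := by
  have hx2 : 0 < x / 2 := half_pos hx.1
  have h1 : IntegrableOn W (Ioo (x / 2) 1) := by
    refine ((hW.mono_set (Ioo_subset_Ioo_left hx2.le)).norm.const_mul (x / 2)⁻¹).mono'
      (hWm.mono_set (Ioo_subset_Ioo_left hx2.le)) ?_
    rw [ae_restrict_iff' measurableSet_Ioo]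
    refine ae_of_all _ fun s hs => ?_
    rw [norm_mul, ← mul_assoc, Real.norm_of_nonneg (hx2.trans hs.1).le]
    refine le_mul_of_one_le_left (norm_nonneg _) ?_
    rw [inv_mul_eq_div, one_le_div hx2]
    exact hs.1.le
  have hlt : x / 2 < 1 := (half_lt_self hx.1).trans hx.2
  rw [← integrableOn_Icc_iff_integrableOn_Ioo] at h1
  have h2 : ContinuousOn (fun s => ∫ x in s..1, W x) (Icc (x / 2) 1) := by
    have := intervalIntegral.continuousOn_primitive_interval_left (a := x / 2) (b := 1)
      (μ := volume) (f := W) (by rwa [uIcc_of_le hlt.le])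
    rwa [uIcc_of_le hlt.le] at this
  exact h2.continuousAt (Icc_mem_nhds (half_lt_self hx.1) hx.2)

/-- Integrating by parts twice by means of Fubini's theorem. The boundary terms at `0` vanish
because the twofold primitive of `ψ` does to second order. -/
theorem integral_mul_primitive_primitive {W ψ : ℝ → ℝ}
    (hWm : AEStronglyMeasurable W (volume.restrict (Ioo (0 : ℝ) 1)))
    (hW : IntegrableOn (fun x => x * W x) (Ioo 0 1)) (hψ : IntegrableOn ψ (Ioo 0 1)) :
    ∫ x in Ioo (0 : ℝ) 1, W x * ∫ s in (0 : ℝ)..x, ∫ r in (0 : ℝ)..s, ψ r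
      = ∫ x in Ioo (0 : ℝ) 1, ψ x * ∫ s in x..1, ∫ r in s..1, W r := by
  have hc := continuousOn_primitive_of_integrableOn hψ
  obtain ⟨C, hC⟩ := isCompact_Icc.exists_bound_of_continuousOn hc
  rw [integral_mul_primitive_of_integrable
    (integrable_triangle_of_bounded (C := C) hWm hW
      (integrableOn_of_continuousOn_Icc hc).aestronglyMeasurable
      fun x hx => hC x (Ioo_subset_Icc_self hx)),
    ← integral_mul_primitive (integrableOn_tail hWm hW) hψ]
  simp only [mul_comm]

theorem integrableOn_mul_continuousOn {g p : ℝ → ℝ} (hg : IntegrableOn g (Ioo 0 1))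
    (hp : ContinuousOn p (Icc 0 1)) : IntegrableOn (fun x => g x * p x) (Ioo 0 1) := by
  rw [← integrableOn_Icc_iff_integrableOn_Ioo] at hg ⊢
  exact hg.mul_continuousOn hp isCompact_Icc

theorem HasWeakDeriv.integral_mul_deriv {g h φ : ℝ → ℝ} (hg : HasWeakDeriv 1 g h)
    (hφ : IsTest φ) :
    ∫ x in Ioo (0 : ℝ) 1, g x * deriv φ x = - ∫ x in Ioo (0 : ℝ) 1, h x * φ x := by
  have := hg.2.2 φ hφ.contDiff hφ.hasCompactSupport hφ.tsupport_subset
  rw [iteratedDeriv_one] at this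
  rw [this]; ring

theorem IsDegenerateWeight.integral_mul_fourth_deriv (ha : IsDegenerateWeight a) (u : H2w a)
    {φ : ℝ → ℝ} (hφ : IsTest φ) :
    ∫ x in Ioo (0 : ℝ) 1, toL2w u x * iteratedDeriv 4 φ x
      = ∫ x in Ioo (0 : ℝ) 1, d2 u x * deriv (deriv φ) x := by
  have h1 : HasWeakDeriv 1 (rep u) (derivRep u) :=
    hasWeakDeriv_one_primitive (integrableOn_of_continuousOn_Icc (continuousOn_derivRep u))
  have h2 : HasWeakDeriv 1 (derivRep u) (d2 u) := hasWeakDeriv_one_primitive (integrable_L2 _)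
  have h3 : iteratedDeriv 4 φ = deriv (deriv (deriv (deriv φ))) := by
    simp only [iteratedDeriv_succ, iteratedDeriv_zero]
  have h4 : ∫ x in Ioo (0 : ℝ) 1, toL2w u x * iteratedDeriv 4 φ x
      = ∫ x in Ioo (0 : ℝ) 1, rep u x * deriv (deriv (deriv (deriv φ))) x :=
    integral_congr_ae ((ha.toL2w_ae_eq u).mono fun x hx => by simp only [hx, h3])
  rw [h4, h1.integral_mul_deriv hφ.deriv.deriv.deriv, h2.integral_mul_deriv hφ.deriv.deriv, neg_neg]

/-- Elements of `D(A)` are regular up to the boundary: `u''` has a representative `p` that is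
continuous on `[0, 1]`, with integrable derivative `q`. Green's formula holds for every `φ` with
`φ(0) = φ'(0) = φ(1) = 0` and `φ'' = ψ` integrable, with one boundary term `u''(1) φ'(1)`. -/
theorem IsA.exists_green (ha : IsDegenerateWeight a) (hA : IsA a u f) :
    ∃ p q : ℝ → ℝ, ContinuousOn p (Icc 0 1) ∧ IntegrableOn q (Ioo 0 1) ∧
      d2 u =ᵐ[volume.restrict (Ioo (0 : ℝ) 1)] p ∧
      (∀ x ∈ Ioo (0 : ℝ) 1, HasDerivAt p (q x) x) ∧
      ∀ ψ : ℝ → ℝ, IntegrableOn ψ (Ioo 0 1) →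
        (∫ s in (0 : ℝ)..1, ∫ r in (0 : ℝ)..s, ψ r) = 0 →
        ∫ x in Ioo (0 : ℝ) 1, f x / a x * ∫ s in (0 : ℝ)..x, ∫ r in (0 : ℝ)..s, ψ r
          = (∫ x in Ioo (0 : ℝ) 1, ψ x * p x) - p 1 * ∫ x in (0 : ℝ)..1, ψ x := by
  set W : ℝ → ℝ := fun x => f x / a x with hWdef
  have hWm : AEStronglyMeasurable W (volume.restrict (Ioo (0 : ℝ) 1)) :=
    ha.aestronglyMeasurable_div f
  have hW : IntegrableOn (fun x => x * W x) (Ioo 0 1) := ha.integrableOn_mul_div f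
  set R : ℝ → ℝ := fun s => ∫ x in s..1, W x with hR
  have hRi : IntegrableOn R (Ioo 0 1) := integrableOn_tail hWm hW
  have hRI : ∀ x ∈ Icc (0 : ℝ) 1, ∀ y ∈ Icc (0 : ℝ) 1, IntervalIntegrable R volume x y :=
    fun x hx y hy => intervalIntegrable_of_integrableOn_Ioo hRi hx hy
  have h0m : (0 : ℝ) ∈ Icc (0 : ℝ) 1 := left_mem_Icc.2 zero_le_one
  have h1m : (1 : ℝ) ∈ Icc (0 : ℝ) 1 := right_mem_Icc.2 zero_le_one
  set P : ℝ → ℝ := fun x => ∫ s in x..1, R s with hP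
  have hPc : ContinuousOn P (Icc 0 1) := by
    have hRc := hRi
    rw [← integrableOn_Icc_iff_integrableOn_Ioo] at hRc
    have := intervalIntegral.continuousOn_primitive_interval_left (a := 0) (b := 1)
      (μ := volume) (f := R) (by rwa [uIcc_of_le zero_le_one])
    rwa [uIcc_of_le zero_le_one] at this
  have hPd : ∀ x ∈ Ioo (0 : ℝ) 1, HasDerivAt P (-R x) x := fun x hx => by
    refine intervalIntegral.integral_hasDerivAt_left (hRI x (Ioo_subset_Icc_self hx) 1 h1m) ?_
      (continuousAt_tail hWm hW hx)
    exact ⟨Ioo 0 1, isOpen_Ioo.mem_nhds hx, hRi.aestronglyMeasurable⟩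
  obtain ⟨c, d, hcd⟩ := ae_affine_of_integral_mul_deriv_deriv_eq_zero
    (h := fun x => d2 u x - P x) ((integrable_L2 _).sub (integrableOn_of_continuousOn_Icc hPc)) (by
    intro φ hφ
    have hi : IntegrableOn (deriv (deriv φ)) (Ioo 0 1) :=
      integrableOn_of_continuousOn_Icc hφ.deriv.deriv.continuous.continuousOn
    have e1 := (hA.hasWeakDeriv ha).2.2 φ hφ.contDiff hφ.hasCompactSupport hφ.tsupport_subset
    have e2 := integral_mul_primitive_primitive hWm hW hi
    simp only [hφ.deriv.eq_primitive_deriv, hφ.eq_primitive_deriv] at e2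
    rw [ha.integral_mul_fourth_deriv u hφ, e2] at e1
    simp only [sub_mul]
    rw [integral_sub (integrableOn_mul_isTest (integrable_L2 _) hφ.deriv.deriv)
      (integrableOn_mul_isTest (integrableOn_of_continuousOn_Icc hPc) hφ.deriv.deriv), e1]
    simp only [mul_comm (P _)]
    ring)
  refine ⟨fun x => P x + (c + d * x), fun x => -R x + d, by fun_prop,
    hRi.neg.add (integrable_const _), ?_, ?_, ?_⟩
  · exact hcd.mono fun x hx => by linarith
  · intro x hx
    refine (hPd x hx).add ?_
    simpa using ((hasDerivAt_id x).const_mul d).const_add c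
  · intro ψ hψ hψ0
    rw [integral_mul_primitive_primitive hWm hW hψ]
    have hid : IntegrableOn (fun x => ψ x * (1 - x)) (Ioo 0 1) :=
      integrableOn_mul_continuousOn hψ (by fun_prop)
    -- The first moment of `ψ` is determined by the vanishing of its twofold primitive at `1`.
    have e1 : ∫ x in Ioo (0 : ℝ) 1, ψ x * (1 - x) = 0 := by
      have := integral_mul_primitive (f := fun _ => 1) (g := ψ) (integrable_const _) hψ
      simp only [one_mul, intervalIntegral.integral_const, smul_eq_mul, mul_one] at this
      rw [← this, integral_Ioo_eq_intervalIntegral, hψ0]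
    have e2 : ∀ x, ψ x * (P x + (c + d * x)) = ψ x * P x + ((c + d) * ψ x - d * (ψ x * (1 - x))) :=
      fun x => by ring
    have hψP : IntegrableOn (fun x => ψ x * P x) (Ioo 0 1) := integrableOn_mul_continuousOn hψ hPc
    have hr : IntegrableOn (fun x => (c + d) * ψ x - d * (ψ x * (1 - x))) (Ioo 0 1) :=
      (hψ.const_mul _).sub (hid.const_mul _)
    have e3 : P 1 = 0 := by simp [hP]
    simp only [e2]
    rw [integral_add hψP hr, integral_sub (hψ.const_mul _) (hid.const_mul _), integral_const_mul,
      integral_const_mul, e1, e3, ← integral_Ioo_eq_intervalIntegral ψ]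
    ring

/-- `A` is the operator of the form `∫ u'' w''`. -/
theorem IsA.inner_eq (ha : IsDegenerateWeight a) (hA : IsA a u f) (w : H2w a) :
    inner ℝ f (toL2w w) = inner ℝ (d2 u) (d2 w) := by
  obtain ⟨p, q, -, -, h3, -, h5⟩ := hA.exists_green ha
  have h6 := h5 (d2 w) (integrable_L2 _) (ha.rep_one w)
  have h7 : ∫ x in (0 : ℝ)..1, d2 w x = 0 := ha.derivRep_one w
  rw [h7, mul_zero, sub_zero] at h6
  rw [ha.inner_L2w, inner_L2]
  calc _ = ∫ x in Ioo (0 : ℝ) 1, f x / a x * rep w x :=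
        integral_congr_ae ((ha.toL2w_ae_eq w).mono fun x hx => by simp only [hx]; ring)
    _ = ∫ x in Ioo (0 : ℝ) 1, d2 w x * p x := h6
    _ = _ := integral_congr_ae (h3.mono fun x hx => by simp only [hx]; ring)

theorem memLp_of_continuous {g : ℝ → ℝ} (hg : Continuous g) :
    MemLp g 2 (volume.restrict (Ioo (0 : ℝ) 1)) := by
  rw [memLp_two_iff_integrable_sq hg.aestronglyMeasurable]
  exact integrableOn_of_continuousOn_Icc (hg.pow 2).continuousOn

/-- The trace `u''(1)` of `u ∈ D(A)`, as a bounded functional of `z = u''` and `f = A u`: by Green's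
formula for `φ(x) = x³ - x²`, it is `∫ u'' φ'' - ∫ f φ / a`. -/
def IsDegenerateWeight.trace (ha : IsDegenerateWeight a) (z : L2) (f : L2w a) : ℝ :=
  inner ℝ z ((memLp_of_continuous (g := fun x => 6 * x - 2) (by fun_prop)).toLp _) -
    inner ℝ f (ha.mulSq ((memLp_of_continuous (g := fun x => x - 1) (by fun_prop)).toLp _))

/-- Green's formula for `φ(x) = x³ - x²`, which has `φ'(1) = 1`, identifies the trace. -/
theorem IsA.trace_eq (ha : IsDegenerateWeight a) {p : ℝ → ℝ}
    (h3 : d2 u =ᵐ[volume.restrict (Ioo (0 : ℝ) 1)] p)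
    (h5 : ∀ ψ : ℝ → ℝ, IntegrableOn ψ (Ioo 0 1) →
        (∫ s in (0 : ℝ)..1, ∫ r in (0 : ℝ)..s, ψ r) = 0 →
        ∫ x in Ioo (0 : ℝ) 1, f x / a x * ∫ s in (0 : ℝ)..x, ∫ r in (0 : ℝ)..s, ψ r
          = (∫ x in Ioo (0 : ℝ) 1, ψ x * p x) - p 1 * ∫ x in (0 : ℝ)..1, ψ x) :
    ha.trace (d2 u) f = p 1 := by
  have e1 : ∀ x : ℝ, ∫ s in (0 : ℝ)..x, (6 * s - 2) = 3 * x ^ 2 - 2 * x := fun x => by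
    rw [intervalIntegral.integral_eq_sub_of_hasDerivAt (f := fun s => 3 * s ^ 2 - 2 * s)
      (fun s _ => by
        have h : HasDerivAt (fun s => 3 * s ^ 2 - 2 * s) _ s :=
          ((hasDerivAt_pow 2 s).const_mul 3).sub ((hasDerivAt_id s).const_mul 2)
        exact h.congr_deriv (by norm_num; ring))
      ((by fun_prop : Continuous fun s : ℝ => 6 * s - 2).intervalIntegrable _ _)]
    ring
  have e2 : ∀ x : ℝ, ∫ s in (0 : ℝ)..x, (3 * s ^ 2 - 2 * s) = x ^ 3 - x ^ 2 := fun x => by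
    rw [intervalIntegral.integral_eq_sub_of_hasDerivAt (f := fun s => s ^ 3 - s ^ 2)
      (fun s _ => by
        have h : HasDerivAt (fun s => s ^ 3 - s ^ 2) _ s :=
          (hasDerivAt_pow 3 s).sub (hasDerivAt_pow 2 s)
        exact h.congr_deriv (by norm_num))
      ((by fun_prop : Continuous fun s : ℝ => 3 * s ^ 2 - 2 * s).intervalIntegrable _ _)]
    ring
  have h6 := h5 (fun x => 6 * x - 2)
    (integrableOn_of_continuousOn_Icc (by fun_prop)) (by simp only [e1, e2]; norm_num)
  simp only [e1, e2] at h6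
  rw [IsDegenerateWeight.trace, ha.inner_mulSq, inner_L2]
  have k1 : ∫ x in Ioo (0 : ℝ) 1, d2 u x * ((memLp_of_continuous (g := fun x => 6 * x - 2)
      (by fun_prop)).toLp _ : L2) x = ∫ x in Ioo (0 : ℝ) 1, (6 * x - 2) * p x := by
    refine integral_congr_ae ?_
    filter_upwards [h3, (memLp_of_continuous (g := fun x => 6 * x - 2) (by fun_prop)).coeFn_toLp]
      with x hx hx'
    rw [hx, hx']; ring
  have k2 : ∫ x in Ioo (0 : ℝ) 1, f x / a x * (x ^ 2 * ((memLp_of_continuous (g := fun x => x - 1)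
      (by fun_prop)).toLp _ : L2) x) = ∫ x in Ioo (0 : ℝ) 1, f x / a x * (x ^ 3 - x ^ 2) := by
    refine integral_congr_ae ?_
    filter_upwards [(memLp_of_continuous (g := fun x => x - 1) (by fun_prop)).coeFn_toLp]
      with x hx
    rw [hx]; ring
  rw [k1, k2, h6]
  norm_num

theorem IsA.hasSecondDerivAtOne_trace (ha : IsDegenerateWeight a) (hA : IsA a u f) :
    HasSecondDerivAtOne u (ha.trace (d2 u) f) := by
  obtain ⟨p, q, h1, -, h3, -, h5⟩ := hA.exists_green ha
  exact ⟨p, h1.mono Ioc_subset_Icc_self, h3, (IsA.trace_eq ha h3 h5).symm⟩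

/-- The value `u''(1)` is well defined. -/
theorem HasSecondDerivAtOne.unique {c c' : ℝ} (h : HasSecondDerivAtOne u c)
    (h' : HasSecondDerivAtOne u c') : c = c' := by
  obtain ⟨w, h1, h2, rfl⟩ := h
  obtain ⟨w', h1', h2', rfl⟩ := h'
  exact eqOn_Ioc_of_ae_eq h1 h1' (h2.symm.trans h2') (right_mem_Ioc.2 zero_lt_one)

/-- The multiplier `x² u'` tested against `A u`:
`∫ u'''' x² u' = 3 ∫ x (u'')² - ½ u''(1)²`, where the first term is estimated. -/
theorem IsA.inner_mulSq_le (ha : IsDegenerateWeight a) (hA : IsA a u f) :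
    inner ℝ f (ha.mulSq (d1L a u)) ≤ 3 * ‖d2 u‖ ^ 2 - 1 / 2 * ha.trace (d2 u) f ^ 2 := by
  obtain ⟨p, q, h1, h2, h3, h4, h5⟩ := hA.exists_green ha
  rw [IsA.trace_eq ha h3 h5]
  set U := derivRep u with hU
  have hUc : ContinuousOn U (Icc 0 1) := continuousOn_derivRep u
  have hU0 : U 0 = 0 := derivRep_zero u
  have hU1 : U 1 = 0 := ha.derivRep_one u
  have h0m : (0 : ℝ) ∈ Icc (0 : ℝ) 1 := left_mem_Icc.2 zero_le_one
  have hpi := integrableOn_of_continuousOn_Icc h1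
  have hUp : ∀ x ∈ Icc (0 : ℝ) 1, U x = ∫ s in (0 : ℝ)..x, p s := fun x hx => by
    rw [hU, derivRep, intervalIntegral.integral_of_le hx.1, intervalIntegral.integral_of_le hx.1,
      integral_Ioc_eq_integral_Ioo, integral_Ioc_eq_integral_Ioo]
    exact integral_congr_ae
      (ae_restrict_of_ae_restrict_of_subset (Ioo_subset_Ioo_right hx.2) h3)
  have hUd : ∀ x ∈ Ioo (0 : ℝ) 1, HasDerivAt U (p x) x := fun x hx => by
    have k := intervalIntegral.integral_hasDerivAt_right
      (intervalIntegrable_of_integrableOn_Ioo hpi h0m (Ioo_subset_Icc_self hx))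
      ⟨Ioo 0 1, isOpen_Ioo.mem_nhds hx, hpi.aestronglyMeasurable⟩
      (h1.continuousAt (Icc_mem_nhds hx.1 hx.2))
    refine k.congr_of_eventuallyEq ?_
    filter_upwards [Icc_mem_nhds hx.1 hx.2] with s hs using hUp s hs
  have hqx : IntegrableOn (fun x => q x * x ^ 2) (Ioo 0 1) :=
    integrableOn_mul_continuousOn h2 (by fun_prop)
  set ψ : ℝ → ℝ := fun x => (2 * U x + 4 * x * p x) + q x * x ^ 2 with hψ
  have hψi : IntegrableOn ψ (Ioo 0 1) :=
    (integrableOn_of_continuousOn_Icc (by fun_prop)).add hqx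
  have e1 : ∀ x ∈ Icc (0 : ℝ) 1, ∫ s in (0 : ℝ)..x, ψ s = 2 * x * U x + x ^ 2 * p x :=
    fun x hx => by
      rw [intervalIntegral.integral_eq_sub_of_hasDerivAt_of_le hx.1
        (f := fun x => 2 * x * U x + x ^ 2 * p x)
        (ContinuousOn.mono (by fun_prop) (Icc_subset_Icc_right hx.2)) (fun s hs => by
          have hs' : s ∈ Ioo (0 : ℝ) 1 := ⟨hs.1, hs.2.trans_le hx.2⟩
          have h : HasDerivAt (fun x => 2 * x * U x + x ^ 2 * p x) _ s :=
            (((hasDerivAt_id s).const_mul 2).mul (hUd s hs')).add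
              ((hasDerivAt_pow 2 s).mul (h4 s hs'))
          exact h.congr_deriv (by simp [ψ]; ring))
        (intervalIntegrable_of_integrableOn_Ioo hψi h0m hx)]
      simp
  have e2 : ∀ x ∈ Icc (0 : ℝ) 1, ∫ s in (0 : ℝ)..x, ∫ r in (0 : ℝ)..s, ψ r = x ^ 2 * U x :=
    fun x hx => by
      have hsub : Icc 0 x ⊆ Icc (0 : ℝ) 1 := Icc_subset_Icc_right hx.2
      rw [intervalIntegral.integral_congr (g := fun s => 2 * s * U s + s ^ 2 * p s) (fun s hs => by
          rw [uIcc_of_le hx.1] at hs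
          exact e1 s (hsub hs)),
        intervalIntegral.integral_eq_sub_of_hasDerivAt_of_le hx.1
        (f := fun x => x ^ 2 * U x)
        (ContinuousOn.mono (by fun_prop) hsub) (fun s hs => by
          have hs' : s ∈ Ioo (0 : ℝ) 1 := ⟨hs.1, hs.2.trans_le hx.2⟩
          have h : HasDerivAt (fun x => x ^ 2 * U x) _ s :=
            (hasDerivAt_pow 2 s).mul (hUd s hs')
          exact h.congr_deriv (by simp))
        (intervalIntegrable_of_integrableOn_Ioo
          (integrableOn_of_continuousOn_Icc (by fun_prop)) h0m hx)]
      simp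
  have h1m : (1 : ℝ) ∈ Icc (0 : ℝ) 1 := right_mem_Icc.2 zero_le_one
  have h6 := h5 ψ hψi (by rw [e2 1 h1m, hU1, mul_zero])
  rw [e1 1 h1m, hU1] at h6
  have h7 : ∫ x in Ioo (0 : ℝ) 1, f x / a x * ∫ s in (0 : ℝ)..x, ∫ r in (0 : ℝ)..s, ψ r
      = inner ℝ f (ha.mulSq (d1L a u)) := by
    rw [ha.inner_mulSq]
    refine integral_congr_ae ?_
    filter_upwards [ha.d1_ae_eq u, ae_restrict_mem measurableSet_Ioo] with x hx hx'
    rw [hx, e2 x (Ioo_subset_Icc_self hx')]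
  have hxp : IntegrableOn (fun x => 3 * (x * p x ^ 2)) (Ioo 0 1) :=
    integrableOn_of_continuousOn_Icc (by fun_prop)
  have hψp := integrableOn_mul_continuousOn hψi h1
  have hψxp : IntegrableOn (fun x => ψ x * p x - 3 * (x * p x ^ 2)) (Ioo 0 1) := hψp.sub hxp
  have h8 : (∫ x in Ioo (0 : ℝ) 1, ψ x * p x) - ∫ x in Ioo (0 : ℝ) 1, 3 * (x * p x ^ 2)
      = 1 / 2 * p 1 ^ 2 := by
    rw [← integral_sub hψp hxp, integral_Ioo_eq_intervalIntegral,
      intervalIntegral.integral_eq_sub_of_hasDerivAt_of_le zero_le_one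
        (f := fun x => U x ^ 2 + 1 / 2 * (x ^ 2 * p x ^ 2)) (by fun_prop) (fun s hs => by
          have h : HasDerivAt (fun x => U x ^ 2 + 1 / 2 * (x ^ 2 * p x ^ 2)) _ s :=
            ((hUd s hs).pow 2).add
              (((hasDerivAt_pow 2 s).mul ((h4 s hs).pow 2)).const_mul (1 / 2))
          exact h.congr_deriv (by simp [ψ]; ring))
        (intervalIntegrable_of_integrableOn_Ioo hψxp h0m h1m)]
    simp [hU0, hU1]
  have h9 : ∫ x in Ioo (0 : ℝ) 1, 3 * (x * p x ^ 2) ≤ 3 * ‖d2 u‖ ^ 2 := by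
    rw [integral_const_mul, norm_sq_L2]
    refine mul_le_mul_of_nonneg_left ?_ zero_le_three
    rw [integral_congr_ae (h3.mono fun x hx => by simp only [hx] :
      (fun x => d2 u x ^ 2) =ᵐ[volume.restrict (Ioo (0 : ℝ) 1)] fun x => p x ^ 2)]
    refine setIntegral_mono_on (integrableOn_of_continuousOn_Icc (by fun_prop))
      (integrableOn_of_continuousOn_Icc (by fun_prop)) measurableSet_Ioo fun x hx => ?_
    exact mul_le_of_le_one_left (sq_nonneg _) hx.2.le
  rw [← h7, h6]
  linarith

/-- The multiplier tested against the velocity: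
`∫ (x² / a) w w' = -½ ∫ (x² / a)' w²`, and `(x² / a)' ≤ 4 / a`. -/
theorem IsDegenerateWeight.neg_inner_mulSq_le (ha : IsDegenerateWeight a) (w : H2w a) :
    -inner ℝ (toL2w w) (ha.mulSq (d1L a w)) ≤ 2 * ‖toL2w w‖ ^ 2 := by
  have h0m : (0 : ℝ) ∈ Icc (0 : ℝ) 1 := left_mem_Icc.2 zero_le_one
  have h1m : (1 : ℝ) ∈ Icc (0 : ℝ) 1 := right_mem_Icc.2 zero_le_one
  set m : ℝ → ℝ := fun x => x ^ 2 / a x with hm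
  set r := rep w with hr
  set U := derivRep w with hU
  have hUc : ContinuousOn U (Icc 0 1) := continuousOn_derivRep w
  have hrc : ContinuousOn r (Icc 0 1) := continuousOn_rep w
  have hrd : ∀ x ∈ Ioo (0 : ℝ) 1, HasDerivAt r (U x) x := fun x hx =>
    intervalIntegral.integral_hasDerivAt_right
      (intervalIntegrable_of_integrableOn_Ioo (integrableOn_of_continuousOn_Icc hUc) h0m
        (Ioo_subset_Icc_self hx))
      ⟨Ioo 0 1, isOpen_Ioo.mem_nhds hx, (integrableOn_of_continuousOn_Icc hUc).aestronglyMeasurable⟩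
      (hUc.continuousAt (Icc_mem_nhds hx.1 hx.2))
  have hmc : ContinuousOn m (Ioc 0 1) :=
    ContinuousOn.div (by fun_prop) (ha.continuousOn.mono Ioc_subset_Icc_self)
      fun x hx => (ha.pos x hx).ne'
  have hmb : ∀ x ∈ Ioc (0 : ℝ) 1, |m x| ≤ 1 / a 1 := fun x hx => by
    rw [abs_of_nonneg (div_nonneg (sq_nonneg _) (ha.pos x hx).le)]
    exact ha.multiplier_le hx
  have i1 : IntegrableOn (fun x => m x * (r x * U x)) (Ioo 0 1) := by
    refine (integrableOn_of_continuousOn_Icc (hrc.mul hUc)).bdd_mul (c := 1 / a 1)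
      ((hmc.mono Ioo_subset_Ioc_self).aestronglyMeasurable measurableSet_Ioo) ?_
    rw [ae_restrict_iff' measurableSet_Ioo]
    exact ae_of_all _ fun x hx => hmb x (Ioo_subset_Ioc_self hx)
  have hrL : IntegrableOn (fun x => r x ^ 2 / a x) (Ioo 0 1) := by
    have := ha.integrable_L2w_mul (toL2w w) (toL2w w)
    refine this.congr ((ha.toL2w_ae_eq w).mono fun x hx => ?_)
    simp only [hx]; ring
  have i2 : IntegrableOn (fun x => IsDegenerateWeight.multiplierDeriv a x * r x ^ 2) (Ioo 0 1) := by
    refine (hrL.const_mul 4).mono' ((ha.continuousOn_multiplierDeriv.mul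
      ((hrc.mono Ioo_subset_Icc_self).pow 2)).aestronglyMeasurable measurableSet_Ioo) ?_
    rw [ae_restrict_iff' measurableSet_Ioo]
    refine ae_of_all _ fun x hx => ?_
    rw [Real.norm_of_nonneg (mul_nonneg (ha.multiplierDeriv_nonneg hx) (sq_nonneg _))]
    calc _ ≤ 4 / a x * r x ^ 2 :=
          mul_le_mul_of_nonneg_right (ha.multiplierDeriv_le hx) (sq_nonneg _)
      _ = _ := by ring
  have i12 : IntegrableOn (fun x => IsDegenerateWeight.multiplierDeriv a x * r x ^ 2
      + 2 * (m x * (r x * U x))) (Ioo 0 1) := i2.add (i1.const_mul 2)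
  have hF : ContinuousOn (fun x => m x * r x ^ 2) (Icc 0 1) := by
    intro x hx
    rcases hx.1.eq_or_lt with rfl | hx0
    · have h1 : Tendsto (fun x => 1 / a 1 * r x ^ 2) (𝓝[Icc 0 1] 0) (𝓝 0) := by
        have h2 := ((hrc 0 h0m).pow 2).const_mul (1 / a 1)
        simpa [ContinuousWithinAt, hr, rep_zero] using h2
      have h3 : m 0 * r 0 ^ 2 = 0 := by simp [hm]
      rw [ContinuousWithinAt, h3]
      refine squeeze_zero_norm' ?_ h1
      filter_upwards [self_mem_nhdsWithin] with x hx
      rw [norm_mul, Real.norm_of_nonneg (sq_nonneg (r x))]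
      refine mul_le_mul_of_nonneg_right ?_ (sq_nonneg _)
      rcases hx.1.eq_or_lt with rfl | hx0
      · simpa [hm] using ha.one_pos.le
      · exact hmb x ⟨hx0, hx.2⟩
    · have h1 : ContinuousWithinAt m (Icc 0 1) x :=
        (hmc x ⟨hx0, hx.2⟩).mono_of_mem_nhdsWithin (by
          filter_upwards [self_mem_nhdsWithin, mem_nhdsWithin_of_mem_nhds (Ioi_mem_nhds hx0)]
            with y hy hy' using ⟨hy', hy.2⟩)
      exact h1.mul ((hrc x hx).pow 2)
  have key : (∫ x in Ioo (0 : ℝ) 1, (IsDegenerateWeight.multiplierDeriv a x * r x ^ 2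
      + 2 * (m x * (r x * U x)))) = 0 := by
    rw [integral_Ioo_eq_intervalIntegral,
      intervalIntegral.integral_eq_sub_of_hasDerivAt_of_le zero_le_one hF (fun s hs => by
        have h : HasDerivAt (fun x => m x * r x ^ 2) _ s :=
          (ha.hasDerivAt_multiplier hs).mul ((hrd s hs).pow 2)
        exact h.congr_deriv (by simp [hm]; ring))
      (intervalIntegrable_of_integrableOn_Ioo i12 h0m h1m)]
    simp [hr, rep_zero, ha.rep_one]
  rw [integral_add i2 (i1.const_mul 2), integral_const_mul] at key
  have k1 : inner ℝ (toL2w w) (ha.mulSq (d1L a w)) = ∫ x in Ioo (0 : ℝ) 1, m x * (r x * U x) := by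
    rw [ha.inner_mulSq]
    refine integral_congr_ae ?_
    filter_upwards [ha.d1_ae_eq w, ha.toL2w_ae_eq w] with x hx hx'
    rw [hx, hx']
    simp only [hm]
    ring
  have k2 : ‖toL2w w‖ ^ 2 = ∫ x in Ioo (0 : ℝ) 1, r x ^ 2 / a x := by
    rw [ha.norm_sq_L2w]
    exact integral_congr_ae ((ha.toL2w_ae_eq w).mono fun x hx => by simp only [hx]; rfl)
  have k3 : ∫ x in Ioo (0 : ℝ) 1, IsDegenerateWeight.multiplierDeriv a x * r x ^ 2
      ≤ ∫ x in Ioo (0 : ℝ) 1, 4 * (r x ^ 2 / a x) := by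
    refine setIntegral_mono_on i2 (hrL.const_mul 4) measurableSet_Ioo fun x hx => ?_
    calc _ ≤ 4 / a x * r x ^ 2 :=
          mul_le_mul_of_nonneg_right (ha.multiplierDeriv_le hx) (sq_nonneg _)
      _ = _ := by ring
  rw [integral_const_mul] at k3
  rw [k1, k2]
  linarith

end Domain

/-! ### Classical solutions: conservation of energy and the trace estimate -/

section Classical

variable {a : ℝ → ℝ} {y y₁ y₂ : ℝ → H2w a} {v v₁ v₂ : ℝ → L2w a}

theorem IsClassicalSolution.sub (ha : IsDegenerateWeight a) (h₁ : IsClassicalSolution a y₁ v₁)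
    (h₂ : IsClassicalSolution a y₂ v₂) : IsClassicalSolution a (y₁ - y₂) (v₁ - v₂) := by
  obtain ⟨w₁, f₁, hw₁, hf₁, h₁⟩ := h₁
  obtain ⟨w₂, f₂, hw₂, hf₂, h₂⟩ := h₂
  refine ⟨w₁ - w₂, f₁ - f₂, hw₁.sub hw₂, hf₁.sub hf₂, fun t ht => ?_⟩
  obtain ⟨a₁, b₁, c₁, d₁⟩ := h₁ t ht
  obtain ⟨a₂, b₂, c₂, d₂⟩ := h₂ t ht
  refine ⟨a₁.sub a₂, ?_, (c₁.sub c₂).congr_deriv ?_, d₁.sub ha d₂⟩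
  · rw [Pi.sub_apply, Pi.sub_apply, ← b₁, ← b₂]
    exact map_sub (toL2wL a) _ _
  · rw [Pi.sub_apply]; abel

theorem HasSecondDerivAtOne.sub {u₁ u₂ : H2w a} {c₁ c₂ : ℝ} (h₁ : HasSecondDerivAtOne u₁ c₁)
    (h₂ : HasSecondDerivAtOne u₂ c₂) : HasSecondDerivAtOne (u₁ - u₂) (c₁ - c₂) := by
  obtain ⟨p₁, k₁, l₁, rfl⟩ := h₁
  obtain ⟨p₂, k₂, l₂, rfl⟩ := h₂
  refine ⟨p₁ - p₂, k₁.sub k₂, ?_, rfl⟩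
  have : d2 (u₁ - u₂) = d2 u₁ - d2 u₂ := map_sub (d2L a) u₁ u₂
  rw [this]
  exact (Lp.coeFn_sub _ _).trans (l₁.sub l₂)

theorem hasDerivWithinAt_clm {E F : Type*} [NormedAddCommGroup E] [NormedSpace ℝ E]
    [NormedAddCommGroup F] [NormedSpace ℝ F] (L : E →L[ℝ] F) {g : ℝ → E} {g' : E} {s : Set ℝ}
    {t : ℝ} (h : HasDerivWithinAt g g' s t) : HasDerivWithinAt (fun t => L (g t)) (L g') s t :=
  L.hasFDerivAt.comp_hasDerivWithinAt t h

/-- The energy is constant along classical solutions. -/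
theorem IsClassicalSolution.norm_sq_add_norm_sq_eq (ha : IsDegenerateWeight a)
    (h : IsClassicalSolution a y v) {t : ℝ} (ht : 0 ≤ t) :
    ‖d2 (y t)‖ ^ 2 + ‖v t‖ ^ 2 = ‖d2 (y 0)‖ ^ 2 + ‖v 0‖ ^ 2 := by
  obtain ⟨w, f, -, -, h⟩ := h
  have hd : ∀ s ∈ Ici (0 : ℝ),
      HasDerivWithinAt (fun s => ‖d2 (y s)‖ ^ 2 + ‖v s‖ ^ 2) 0 (Ici 0) s := fun s hs => by
    obtain ⟨h1, h2, h3, h4⟩ := h s hs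
    refine ((hasDerivWithinAt_clm (d2L a) h1).norm_sq.add h3.norm_sq).congr_deriv ?_
    have := h4.inner_eq ha (w s)
    simp only [d2L_apply]
    rw [inner_neg_right, ← h2]
    linarith [real_inner_comm (f s) (toL2w (w s))]
  exact constant_of_has_deriv_right_zero (a := 0) (b := t)
    (fun s hs => ((hd s hs.1).continuousWithinAt.mono Icc_subset_Ici_self))
    (fun s hs => (hd s hs.1).mono (Ici_subset_Ici.2 hs.1)) t (right_mem_Icc.2 ht)

/-- The boundary trace of a classical solution is continuous in time, and controlled by the
energy. -/
theorem IsClassicalSolution.exists_trace (ha : IsDegenerateWeight a)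
    (h : IsClassicalSolution a y v) :
    ∃ c : ℝ → ℝ, ContinuousOn c (Ici 0) ∧ (∀ t ∈ Ici (0 : ℝ), HasSecondDerivAtOne (y t) (c t)) ∧
      ∀ T, 0 < T → ∫ t in Ioo 0 T, c t ^ 2
        ≤ (12 * T + 4 * max (4 / a 1) 1) * energy (y 0) (v 0) := by
  have hE := fun t (ht : 0 ≤ t) => h.norm_sq_add_norm_sq_eq ha ht
  obtain ⟨w, f, hw, hf, h⟩ := h
  have hy : ContinuousOn y (Ici 0) := fun t ht => (h t ht).1.continuousWithinAt
  have hv : ContinuousOn v (Ici 0) := fun t ht => (h t ht).2.2.1.continuousWithinAt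
  have hc : ContinuousOn (fun t => ha.trace (d2 (y t)) (f t)) (Ici 0) :=
    (((d2L a).continuous.comp_continuousOn hy).inner continuousOn_const).sub
      (hf.inner continuousOn_const)
  refine ⟨fun t => ha.trace (d2 (y t)) (f t), hc,
    fun t ht => (h t ht).2.2.2.hasSecondDerivAtOne_trace ha, fun T hT => ?_⟩
  set e := ‖d2 (y 0)‖ ^ 2 + ‖v 0‖ ^ 2 with he
  set μ := max (4 / a 1) 1 with hμ
  have hμ1 : 1 ≤ μ := le_max_right _ _
  have hμ2 : 1 / a 1 ≤ μ := by
    refine le_trans ?_ (le_max_left _ _)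
    have := ha.one_pos
    gcongr
    norm_num
  set M : H2w a →L[ℝ] L2w a := ha.mulSq.comp (d1L a) with hM
  have hMy : ContinuousOn (fun t => M (y t)) (Ici 0) := M.continuous.comp_continuousOn hy
  have hMw : ContinuousOn (fun t => M (w t)) (Ici 0) := M.continuous.comp_continuousOn hw
  -- The multiplier quantity `G(t) = ∫ (x² / a) y_t y_x`.
  set G : ℝ → ℝ := fun t => inner ℝ (v t) (M (y t)) with hG
  set G' : ℝ → ℝ := fun t => inner ℝ (v t) (M (w t)) + inner ℝ (-f t) (M (y t)) with hG'
  have hGd : ∀ t ∈ Ici (0 : ℝ), HasDerivWithinAt G (G' t) (Ici 0) t := fun t ht =>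
    (h t ht).2.2.1.inner ℝ (hasDerivWithinAt_clm M (h t ht).1)
  have hGb : ∀ t, 0 ≤ t → |G t| ≤ 1 / 2 * (μ * e) := fun t ht => by
    have h1 : |G t| ≤ ‖v t‖ * ‖M (y t)‖ := abs_real_inner_le_norm _ _
    have h2 : ‖M (y t)‖ ^ 2 ≤ 1 / a 1 * ‖d1L a (y t)‖ ^ 2 := ha.norm_sq_mulSq_le _
    have h3 : ‖d1L a (y t)‖ ^ 2 ≤ ‖d2 (y t)‖ ^ 2 :=
      pow_le_pow_left₀ (norm_nonneg _) (ha.norm_d1_le (y t)) 2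
    have h4 : 1 / a 1 * ‖d1L a (y t)‖ ^ 2 ≤ μ * ‖d2 (y t)‖ ^ 2 :=
      mul_le_mul hμ2 h3 (sq_nonneg _) (by linarith)
    have h5 := hE t ht
    have h6 : 1 * ‖v t‖ ^ 2 ≤ μ * ‖v t‖ ^ 2 := mul_le_mul_of_nonneg_right hμ1 (sq_nonneg _)
    have h7 := two_mul_le_add_sq ‖v t‖ ‖M (y t)‖
    rw [← h5]
    linarith
  have hG'c : ContinuousOn G' (Icc 0 T) :=
    ((hv.inner hMw).add (hf.neg.inner hMy)).mono Icc_subset_Ici_self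
  have hG'i : IntervalIntegrable G' volume 0 T :=
    ContinuousOn.intervalIntegrable (by rwa [uIcc_of_le hT.le])
  have hFTC : ∫ t in (0 : ℝ)..T, G' t = G T - G 0 :=
    intervalIntegral.integral_eq_sub_of_hasDeriv_right_of_le hT.le
      (fun t ht => (hGd t ht.1).continuousWithinAt.mono Icc_subset_Ici_self)
      (fun t ht => (hGd t ht.1.le).mono fun s hs => ht.1.le.trans (le_of_lt hs)) hG'i
  have hpt : ∀ t ∈ Icc 0 T, ha.trace (d2 (y t)) (f t) ^ 2 ≤ 2 * G' t + 6 * e := fun t ht => by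
    obtain ⟨-, h2, -, h4⟩ := h t ht.1
    have k1 := h4.inner_mulSq_le ha
    have k2 := ha.neg_inner_mulSq_le (w t)
    have k3 := hE t ht.1
    have k4 : G' t = inner ℝ (toL2w (w t)) (ha.mulSq (d1L a (w t)))
        - inner ℝ (f t) (ha.mulSq (d1L a (y t))) := by
      simp only [hG', hM, h2, inner_neg_left, ContinuousLinearMap.comp_apply]
      ring
    rw [h2] at k2 k4
    have := sq_nonneg ‖v t‖
    linarith
  have hmono := intervalIntegral.integral_mono_on hT.le
    (ContinuousOn.intervalIntegrable (μ := volume) (a := 0) (b := T)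
      (u := fun t => ha.trace (d2 (y t)) (f t) ^ 2)
      (by rw [uIcc_of_le hT.le]; exact (hc.mono Icc_subset_Ici_self).pow 2))
    ((hG'i.const_mul 2).add intervalIntegrable_const) hpt
  rw [intervalIntegral.integral_add (hG'i.const_mul 2) intervalIntegrable_const,
    intervalIntegral.integral_const_mul, hFTC, intervalIntegral.integral_const, sub_zero,
    smul_eq_mul, intervalIntegral.integral_of_le hT.le, integral_Ioc_eq_integral_Ioo] at hmono
  rw [ha.energy_eq]
  have b1 := abs_le.1 (hGb T hT.le)
  have b2 := abs_le.1 (hGb 0 le_rfl)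
  linarith [b1.2, b2.1]

/-- The constant of the trace estimate. -/
def traceConst (a : ℝ → ℝ) (T : ℝ) : ℝ := 12 * T + 4 * max (4 / a 1) 1

theorem traceConst_nonneg {T : ℝ} (hT : 0 < T) : 0 ≤ traceConst a T := by
  have : (1 : ℝ) ≤ max (4 / a 1) 1 := le_max_right _ _
  rw [traceConst]
  linarith

theorem norm_sq_Lp_Ioo {T : ℝ} (g : Lp ℝ 2 (volume.restrict (Ioo 0 T))) :
    ‖g‖ ^ 2 = ∫ t in Ioo 0 T, g t ^ 2 := by
  rw [← real_inner_self_eq_norm_sq, L2.inner_def]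
  refine integral_congr_ae (ae_of_all _ fun x => ?_)
  simp [sq]

theorem IsClassicalSolution.exists_Lp_trace (ha : IsDegenerateWeight a)
    (h : IsClassicalSolution a y v) (T : ℝ) :
    ∃ g : Lp ℝ 2 (volume.restrict (Ioo 0 T)),
      ∀ᵐ t ∂(volume.restrict (Ioo 0 T)), HasSecondDerivAtOne (y t) (g t) := by
  obtain ⟨c, h1, h2, -⟩ := h.exists_trace ha
  have hc : ContinuousOn c (Icc 0 T) := h1.mono Icc_subset_Ici_self
  have hL : MemLp c 2 (volume.restrict (Ioo 0 T)) := by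
    rw [memLp_two_iff_integrable_sq
      ((hc.mono Ioo_subset_Icc_self).aestronglyMeasurable measurableSet_Ioo)]
    exact ((hc.pow 2).integrableOn_compact isCompact_Icc).mono_set Ioo_subset_Icc_self
  refine ⟨hL.toLp c, ?_⟩
  filter_upwards [hL.coeFn_toLp, ae_restrict_mem measurableSet_Ioo] with t ht ht'
  rw [ht]
  exact h2 t ht'.1.le

theorem ae_eq_of_hasSecondDerivAtOne {T : ℝ} {g₁ g₂ : ℝ → ℝ}
    (h₁ : ∀ᵐ t ∂(volume.restrict (Ioo 0 T)), HasSecondDerivAtOne (y t) (g₁ t))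
    (h₂ : ∀ᵐ t ∂(volume.restrict (Ioo 0 T)), HasSecondDerivAtOne (y t) (g₂ t)) :
    g₁ =ᵐ[volume.restrict (Ioo 0 T)] g₂ := by
  filter_upwards [h₁, h₂] with t ht ht' using ht.unique ht'

theorem IsClassicalSolution.norm_sq_trace_le (ha : IsDegenerateWeight a)
    (h : IsClassicalSolution a y v) {T : ℝ} (hT : 0 < T)
    {g : Lp ℝ 2 (volume.restrict (Ioo 0 T))}
    (hg : ∀ᵐ t ∂(volume.restrict (Ioo 0 T)), HasSecondDerivAtOne (y t) (g t)) :
    ‖g‖ ^ 2 ≤ traceConst a T * energy (y 0) (v 0) := by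
  obtain ⟨c, -, h2, h3⟩ := h.exists_trace ha
  have hc : ∀ᵐ t ∂(volume.restrict (Ioo 0 T)), HasSecondDerivAtOne (y t) (c t) := by
    filter_upwards [ae_restrict_mem measurableSet_Ioo] with t ht using h2 t ht.1.le
  have h4 := ae_eq_of_hasSecondDerivAtOne hg hc
  rw [norm_sq_Lp_Ioo, integral_congr_ae (h4.mono fun t ht => by simp only [ht] :
    (fun t => g t ^ 2) =ᵐ[volume.restrict (Ioo 0 T)] fun t => c t ^ 2)]
  exact h3 T hT

theorem IsDegenerateWeight.normSqH0_sub_le (ha : IsDegenerateWeight a) (u₁ u₂ u : H2w a)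
    (v₁ v₂ v : L2w a) :
    normSqH0 (u₁ - u₂) (v₁ - v₂)
      ≤ 2 * (normSqH0 (u₁ - u) (v₁ - v) + normSqH0 (u₂ - u) (v₂ - v)) := by
  have key : ∀ {E : Type} [NormedAddCommGroup E] (p q r : E),
      ‖p - q‖ ^ 2 ≤ 2 * (‖p - r‖ ^ 2 + ‖q - r‖ ^ 2) := fun p q r => by
    have h1 : ‖p - q‖ ≤ ‖p - r‖ + ‖q - r‖ := by
      rw [norm_sub_rev q r]
      exact norm_sub_le_norm_sub_add_norm_sub _ _ _
    have h2 := pow_le_pow_left₀ (norm_nonneg _) h1 2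
    nlinarith [sq_nonneg (‖p - r‖ - ‖q - r‖)]
  simp only [ha.normSqH0_eq, ← d2L_apply, map_sub]
  linarith [key (d2L a u₁) (d2L a u₂) (d2L a u), key v₁ v₂ v]

/-- The traces of two classical solutions are close if their initial data are close to the same
state `(u, z)`. -/
theorem IsClassicalSolution.norm_sq_trace_sub_le (ha : IsDegenerateWeight a)
    (h₁ : IsClassicalSolution a y₁ v₁) (h₂ : IsClassicalSolution a y₂ v₂) {T : ℝ} (hT : 0 < T)
    {g₁ g₂ : Lp ℝ 2 (volume.restrict (Ioo 0 T))}
    (hg₁ : ∀ᵐ t ∂(volume.restrict (Ioo 0 T)), HasSecondDerivAtOne (y₁ t) (g₁ t))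
    (hg₂ : ∀ᵐ t ∂(volume.restrict (Ioo 0 T)), HasSecondDerivAtOne (y₂ t) (g₂ t))
    (u : H2w a) (z : L2w a) :
    ‖g₁ - g₂‖ ^ 2 ≤ traceConst a T *
      (normSqH0 (y₁ 0 - u) (v₁ 0 - z) + normSqH0 (y₂ 0 - u) (v₂ 0 - z)) := by
  have h3 := (h₁.sub ha h₂).norm_sq_trace_le ha hT (g := g₁ - g₂) (by
    filter_upwards [hg₁, hg₂, Lp.coeFn_sub g₁ g₂] with t k1 k2 k3
    rw [k3]
    exact k1.sub k2)
  refine h3.trans (mul_le_mul_of_nonneg_left ?_ (traceConst_nonneg hT))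
  have h4 := ha.normSqH0_sub_le (y₁ 0) (y₂ 0) u (v₁ 0) (v₂ 0) z
  have h5 : energy ((y₁ - y₂) 0) ((v₁ - v₂) 0)
      = 1 / 2 * normSqH0 (y₁ 0 - y₂ 0) (v₁ 0 - v₂ 0) := by
    rw [ha.energy_eq, ha.normSqH0_eq, Pi.sub_apply, Pi.sub_apply]
  rw [h5]
  linarith

end Classical

/-! ### Mild solutions: approximation by time means and the boundary trace -/

section Mild

variable {a : ℝ → ℝ} {y : ℝ → H2w a} {v : ℝ → L2w a}

theorem IsA.congr {u u' : H2w a} {f : L2w a} (h : IsA a u f) (hu : toL2w u = toL2w u') :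
    IsA a u' f := by
  obtain ⟨w, h1, h2⟩ := h
  exact ⟨w, hu ▸ h1, h2⟩

theorem continuous_comp_max {E : Type*} [TopologicalSpace E] {g : ℝ → E}
    (hg : ContinuousOn g (Ici 0)) : Continuous fun t => g (max t 0) :=
  hg.comp_continuous (by fun_prop) fun t => le_max_right t 0

theorem hasDerivAt_primitive {E : Type*} [NormedAddCommGroup E] [NormedSpace ℝ E] [CompleteSpace E]
    {g : ℝ → E} (hg : Continuous g) (t : ℝ) : HasDerivAt (fun t => ∫ s in (0 : ℝ)..t, g s) (g t) t :=
  intervalIntegral.integral_hasDerivAt_right (hg.intervalIntegrable _ _)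
    (hg.stronglyMeasurableAtFilter _ _) hg.continuousAt

/-- The mean `h⁻¹ ∫ₜ^(t+h) g`, where `g` is extended to negative times by its value at `0`. -/
def timeMean {E : Type*} [NormedAddCommGroup E] [NormedSpace ℝ E] (g : ℝ → E) (h t : ℝ) : E :=
  h⁻¹ • ((∫ s in (0 : ℝ)..t + h, g (max s 0)) - ∫ s in (0 : ℝ)..t, g (max s 0))

theorem hasDerivAt_timeMean {E : Type*} [NormedAddCommGroup E] [NormedSpace ℝ E] [CompleteSpace E]
    {g : ℝ → E} (hg : ContinuousOn g (Ici 0)) (h t : ℝ) :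
    HasDerivAt (timeMean g h) (h⁻¹ • (g (max (t + h) 0) - g (max t 0))) t := by
  have h1 := continuous_comp_max hg
  have h2 := (hasDerivAt_primitive h1 (t + h)).comp_add_const t h
  exact (h2.sub (hasDerivAt_primitive h1 t)).const_smul h⁻¹

theorem tendsto_timeMean_zero {E : Type*} [NormedAddCommGroup E] [NormedSpace ℝ E]
    [CompleteSpace E] {g : ℝ → E} (hg : ContinuousOn g (Ici 0)) :
    Tendsto (fun n : ℕ => timeMean g (1 / ((n : ℝ) + 1)) 0) atTop (𝓝 (g 0)) := by
  have h1 := (hasDerivAt_primitive (continuous_comp_max hg) 0).tendsto_slope_zero_right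
  have h2 : Tendsto (fun n : ℕ => 1 / ((n : ℝ) + 1)) atTop (𝓝[>] 0) :=
    tendsto_nhdsWithin_iff.2 ⟨tendsto_one_div_add_atTop_nhds_zero_nat,
      Eventually.of_forall fun n => mem_Ioi.2 Nat.one_div_pos_of_nat⟩
  simpa [timeMean, Function.comp_def] using h1.comp h2

/-- Time means of mild solutions are classical solutions. -/
theorem IsMildSolution.isClassicalSolution_timeMean (ha : IsDegenerateWeight a)
    (hy : IsMildSolution a y v) {h : ℝ} (hh : 0 < h) :
    IsClassicalSolution a (timeMean y h) (timeMean v h) := by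
  have := ha.completeSpace_H2w
  have hyc := continuous_comp_max hy.continuousOn
  have hvc := continuous_comp_max hy.continuousOn_vel
  -- On `[0, ∞)` the primitives of `y` and `v` are those of the extended functions.
  have hprim : ∀ t, 0 ≤ t → IsA a (∫ s in (0 : ℝ)..t, y (max s 0)) (v 0 - v t) := fun t ht => by
    obtain ⟨Y, hY, hA⟩ := hy.eqn t ht
    refine hA.congr ?_
    have h1 : toL2w (∫ s in (0 : ℝ)..t, y (max s 0))
        = ∫ s in (0 : ℝ)..t, toL2w (y (max s 0)) :=
      ((toL2wL a).intervalIntegral_comp_comm (hyc.intervalIntegrable 0 t)).symm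
    rw [hY, h1]
    refine intervalIntegral.integral_congr fun s hs => ?_
    rw [uIcc_of_le ht] at hs
    simp only [max_eq_left hs.1]
  have hvel : ∀ t, 0 ≤ t → toL2w (y t) = toL2w (y 0) + ∫ s in (0 : ℝ)..t, v (max s 0) :=
    fun t ht => by
      rw [intervalIntegral.integral_eq_sub_of_hasDeriv_right_of_le ht
        (f := fun s => toL2w (y s))
        (fun s hs => (hy.vel s hs.1).continuousWithinAt.mono Icc_subset_Ici_self)
        (fun s hs => by
          rw [max_eq_left hs.1.le]
          exact (hy.vel s hs.1.le).mono fun r hr => hs.1.le.trans (le_of_lt hr))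
        (hvc.intervalIntegrable _ _)]
      abel
  refine ⟨fun t => h⁻¹ • (y (max (t + h) 0) - y (max t 0)),
    fun t => h⁻¹ • (v (max t 0) - v (max (t + h) 0)), ?_, ?_, fun t ht => ?_⟩
  · exact (((hyc.comp (continuous_add_const h)).sub hyc).const_smul h⁻¹).continuousOn
  · exact ((hvc.sub (hvc.comp (continuous_add_const h))).const_smul h⁻¹).continuousOn
  have ht : 0 ≤ t := ht
  have hth : 0 ≤ t + h := by linarith
  refine ⟨(hasDerivAt_timeMean hy.continuousOn h t).hasDerivWithinAt, ?_,
    (hasDerivAt_timeMean hy.continuousOn_vel h t).hasDerivWithinAt.congr_deriv ?_, ?_⟩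
  · have h1 : toL2w (h⁻¹ • (y (max (t + h) 0) - y (max t 0)))
        = h⁻¹ • (toL2w (y (max (t + h) 0)) - toL2w (y (max t 0))) := by
      simp only [← toL2wL_apply, map_smul, map_sub]
    rw [h1, max_eq_left ht, max_eq_left hth, hvel t ht, hvel _ hth, timeMean]
    congr 1
    abel
  · rw [← smul_neg, neg_sub]
  · have h1 := ((hprim _ hth).sub ha (hprim t ht)).smul ha h⁻¹
    have h2 : v 0 - v (t + h) - (v 0 - v t) = v (max t 0) - v (max (t + h) 0) := by
      rw [max_eq_left ht, max_eq_left hth]; abel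
    rwa [h2] at h1

/-- Classical solutions are dense: the time means of a mild solution over shrinking intervals
approximate it. -/
theorem IsMildSolution.exists_isApproximation (ha : IsDegenerateWeight a)
    (hy : IsMildSolution a y v) : ∃ yn vn, IsApproximation a y v yn vn := by
  have := ha.completeSpace_H2w
  refine ⟨fun n => timeMean y (1 / ((n : ℝ) + 1)), fun n => timeMean v (1 / ((n : ℝ) + 1)),
    fun n => hy.isClassicalSolution_timeMean ha Nat.one_div_pos_of_nat, ?_⟩
  have h1 := (tendsto_timeMean_zero hy.continuousOn).sub_const (y 0)
  have h2 := (tendsto_timeMean_zero hy.continuousOn_vel).sub_const (v 0)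
  rw [sub_self] at h1 h2
  have h3 := (((d2L a).continuous.tendsto 0).comp h1).norm.pow 2 |>.add (h2.norm.pow 2)
  rw [map_zero, norm_zero, norm_zero, zero_pow two_ne_zero, add_zero] at h3
  simp only [ha.normSqH0_eq]
  exact h3

theorem IsApproximation.tendsto_energy (ha : IsDegenerateWeight a) {yn : ℕ → ℝ → H2w a}
    {vn : ℕ → ℝ → L2w a} (h : IsApproximation a y v yn vn) :
    Tendsto (fun n => energy (yn n 0) (vn n 0)) atTop (𝓝 (energy (y 0) (v 0))) := by
  have h0 := h.2
  simp only [ha.normSqH0_eq] at h0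
  have key : ∀ {E : Type} [NormedAddCommGroup E] (s : ℕ → E) (l : E) (r : ℕ → ℝ),
      (∀ n, ‖s n - l‖ ^ 2 ≤ r n) → Tendsto r atTop (𝓝 0) →
      Tendsto (fun n => ‖s n‖ ^ 2) atTop (𝓝 (‖l‖ ^ 2)) := fun s l r h1 h2 => by
    refine Tendsto.pow (Tendsto.norm (tendsto_iff_norm_sub_tendsto_zero.2 ?_)) 2
    have h3 := h2.sqrt
    rw [Real.sqrt_zero] at h3
    exact squeeze_zero (fun _ => norm_nonneg _) (fun n => Real.le_sqrt_of_sq_le (h1 n)) h3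
  simp only [ha.energy_eq]
  refine Tendsto.const_mul _ (Tendsto.add ?_ ?_)
  · refine key _ _ _ (fun n => ?_) h0
    have : d2 (yn n 0) - d2 (y 0) = d2 (yn n 0 - y 0) := (map_sub (d2L a) _ _).symm
    rw [this]
    exact le_add_of_nonneg_right (sq_nonneg _)
  · exact key _ _ _ (fun n => le_add_of_nonneg_left (sq_nonneg _)) h0

/-- The traces of one approximating sequence form a Cauchy sequence; its limit is the limit for every
other approximating sequence, and satisfies the estimate by continuity of the energy. -/
theorem IsMildSolution.exists_boundaryTrace (ha : IsDegenerateWeight a)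
    (hy : IsMildSolution a y v) {T : ℝ} (hT : 0 < T) :
    ∃ g : Lp ℝ 2 (volume.restrict (Ioo 0 T)),
      IsBoundaryTrace a y v T g ∧ ‖g‖ ^ 2 ≤ traceConst a T * energy (y 0) (v 0) := by
  obtain ⟨zn, wn, hz⟩ := hy.exists_isApproximation ha
  choose gz hgz using fun n => (hz.1 n).exists_Lp_trace ha T
  have hlim : ∀ {r : ℕ → ℝ}, Tendsto r atTop (𝓝 0) →
      Tendsto (fun n => √(traceConst a T * r n)) atTop (𝓝 0) := fun hr => by
    simpa using (hr.const_mul (traceConst a T)).sqrt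
  have hcauchy : CauchySeq gz := by
    rw [cauchySeq_iff_tendsto_dist_atTop_0]
    have h1 : Tendsto (fun n : ℕ × ℕ => √(traceConst a T *
        (normSqH0 (zn n.1 0 - y 0) (wn n.1 0 - v 0)
          + normSqH0 (zn n.2 0 - y 0) (wn n.2 0 - v 0)))) atTop (𝓝 0) := by
      rw [← prod_atTop_atTop_eq]
      have h2 := ((hz.2.comp tendsto_fst).add (hz.2.comp tendsto_snd) :
        Tendsto _ ((atTop : Filter ℕ) ×ˢ (atTop : Filter ℕ)) _)
      simpa using (h2.const_mul (traceConst a T)).sqrt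
    refine squeeze_zero (fun _ => dist_nonneg) (fun n => ?_) h1
    rw [dist_eq_norm]
    exact Real.le_sqrt_of_sq_le
      ((hz.1 n.1).norm_sq_trace_sub_le ha (hz.1 n.2) hT (hgz n.1) (hgz n.2) (y 0) (v 0))
  obtain ⟨g, hg⟩ := cauchySeq_tendsto_of_complete hcauchy
  refine ⟨g, ⟨⟨zn, wn, hz⟩, fun yn vn hyn => ?_⟩, ?_⟩
  · choose gn hgn using fun n => (hyn.1 n).exists_Lp_trace ha T
    refine ⟨gn, hgn, ?_⟩
    have h1 : Tendsto (fun n => gn n - gz n) atTop (𝓝 0) := by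
      rw [tendsto_zero_iff_norm_tendsto_zero]
      have h2 := hyn.2.add hz.2
      rw [add_zero] at h2
      exact squeeze_zero (fun _ => norm_nonneg _) (fun n => Real.le_sqrt_of_sq_le
        ((hyn.1 n).norm_sq_trace_sub_le ha (hz.1 n) hT (hgn n) (hgz n) (y 0) (v 0))) (hlim h2)
    simpa using h1.add hg
  · exact le_of_tendsto_of_tendsto' (hg.norm.pow 2)
      ((hz.tendsto_energy ha).const_mul (traceConst a T))
      fun n => (hz.1 n).norm_sq_trace_le ha hT (hgz n)

theorem IsBoundaryTrace.unique {T : ℝ} {g h : Lp ℝ 2 (volume.restrict (Ioo 0 T))}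
    (hg : IsBoundaryTrace a y v T g) (hh : IsBoundaryTrace a y v T h) : h = g := by
  obtain ⟨⟨yn, vn, hyn⟩, hg⟩ := hg
  obtain ⟨g₁, k₁, l₁⟩ := hg yn vn hyn
  obtain ⟨g₂, k₂, l₂⟩ := hh.2 yn vn hyn
  have : g₁ = g₂ := funext fun n => Lp.ext (ae_eq_of_hasSecondDerivAtOne (k₁ n) (k₂ n))
  subst this
  exact tendsto_nhds_unique l₂ l₁

theorem IsBoundaryTrace.hasSecondDerivAtOne {T : ℝ} {g : Lp ℝ 2 (volume.restrict (Ioo 0 T))}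
    (ha : IsDegenerateWeight a) (hg : IsBoundaryTrace a y v T g)
    (hy : IsClassicalSolution a y v) :
    ∀ᵐ t ∂(volume.restrict (Ioo 0 T)), HasSecondDerivAtOne (y t) (g t) := by
  -- A classical solution is approximated by the constant sequence.
  obtain ⟨gn, k, l⟩ := hg.2 (fun _ => y) (fun _ => v)
    ⟨fun _ => hy, by
      have : normSqH0 (0 : H2w a) (0 : L2w a) = 0 := by
        have h0 : d2 (0 : H2w a) = 0 := map_zero (d2L a)
        rw [ha.normSqH0_eq, h0]
        simp
      simp [this]⟩
  have hconst : ∀ n, gn n = gn 0 := fun n =>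
    Lp.ext (ae_eq_of_hasSecondDerivAtOne (k n) (k 0))
  have : g = gn 0 := tendsto_nhds_unique (l.congr hconst) tendsto_const_nhds
  rw [this]
  exact k 0

end Mild

end DegenerateBeam

end

theorem mainTheorem4 (a : ℝ → ℝ)
    (ha : DegenerateBeam.WeaklyDegenerate a ∨ DegenerateBeam.StronglyDegenerate a)
    (y : ℝ → DegenerateBeam.H2w a) (v : ℝ → DegenerateBeam.L2w a)
    (hy : DegenerateBeam.IsMildSolution a y v) (T : ℝ) (hT : 0 < T) :
    ∃ g : Lp ℝ 2 (volume.restrict (Ioo 0 T)),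
      DegenerateBeam.IsBoundaryTrace a y v T g ∧
      (∀ h : Lp ℝ 2 (volume.restrict (Ioo 0 T)),
        DegenerateBeam.IsBoundaryTrace a y v T h → h = g) ∧
      (DegenerateBeam.IsClassicalSolution a y v →
        ∀ᵐ t ∂(volume.restrict (Ioo 0 T)), DegenerateBeam.HasSecondDerivAtOne (y t) (g t)) ∧
      ∫ t in Ioo (0 : ℝ) T, g t ^ 2
        ≤ (12 * T + 4 * max (4 / a 1) 1) * DegenerateBeam.energy (y 0) (v 0) := by
  have hw : DegenerateBeam.IsDegenerateWeight a :=
    ha.elim (fun h => h.isDegenerateWeight) fun h => h.isDegenerateWeight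
  obtain ⟨g, hg, hle⟩ := hy.exists_boundaryTrace hw hT
  refine ⟨g, hg, fun h hh => hg.unique hh, fun hc => hg.hasSecondDerivAtOne hw hc, ?_⟩
  rwa [← DegenerateBeam.norm_sq_Lp_Ioo]
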